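/- Let $\mathfrak{X}$ be a Cantor space (a topological space homeomorphic to the Cantor set) and let $G$ be the group of all self-homeomorphisms of $\mathfrak{X}$. For $\mathfrak{A}\subset\mathfrak{X}$ let $G\{\mathfrak{A}\}=\{g\in G : g\mathfrak{A}=\mathfrak{A}\}$. Give $G$ the group topology in which the subgroups $G\{\mathfrak{A}_1\}\cap\cdots\cap G\{\mathfrak{A}_n\}$, with $\mathfrak{A}_1,\ldots,\mathfrak{A}_n$ clopen in $\mathfrak{X}$, form a neighborhood basis of the identity. A finitary $G$-set is a set with an action of $G$ such that all stabilizers are open and there are only finitely many orbits; it is transitive if it has exactly one orbit. Maps of $G$-sets are $G$-equivariant maps. A $\mathbf{Q}$-valued measure for $G$ is a rule $\mu$ assigning to each map $f\colon X\to Y$ of finitary $G$-sets, with $Y$ transitive, a number $\mu(f)\in\mathbf{Q}$ such that: (1) $\mu(f)=1$ if $f$ is an isomorphism; (2) if $X=X_1\amalg X_2$ is a decomposition of $G$-sets, then $\mu(f)=\mu(f|_{X_1})+\mu(f|_{X_2})$; (3) if $g\colon Y\to Z$ is a map of transitive $G$-sets, then $\mu(g\circ f)=\mu(g)\,\mu(f)$;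 (4) if $Y'\to Y$ is a map of transitive $G$-sets and $f'\colon X'\to Y'$ is the base change of $f$, then $\mu(f')=\mu(f)$. Write $\mu(X)=\mu(X\to\mathbf{1})$, where $\mathbf{1}$ is the one-point $G$-set. The measure $\mu$ is regular if $\mu(f)\neq 0$ for every map $f$ between transitive $G$-sets. For $n\ge 1$ let $X(n)$ be the set of surjective continuous maps $\mathfrak{X}\to\{1,\ldots,n\}$ (discrete target), on which $G$ acts by $g\cdot\varphi=\varphi\circ g^{-1}$; it is a transitive finitary $G$-set. Theorem. There is a unique regular $\mathbf{Q}$-valued measure $\mu$ for $G$ such that $\mu(X(n))=(-2)^{n-1}$ for all $n\ge 1$, and there is a unique regular $\mathbf{Q}$-valued measure $\nu$ for $G$ such that $\nu(X(n))=(-1)^{n-1}$ for all $n\ge 1$. -/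

import Mathlib

universe u

namespace CantorMeas

section GSets

/-- A finitary smooth `G`-set: a set with an action of the topological group `G` such that all
stabilizers are open and there are finitely many orbits. -/
structure FinGSet (G : Type u) [Group G] [TopologicalSpace G] where
  carrier : Type u
  action : MulAction G carrier
  smooth : ∀ x : carrier, IsOpen (MulAction.stabilizer G x : Set G)
  finitary : Finite (MulAction.orbitRel.Quotient G carrier)

variable {G : Type u} [Group G] [TopologicalSpace G]

instance : CoeSort (FinGSet G) (Type u) := ⟨FinGSet.carrier⟩

instance (X : FinGSet G) : MulAction G X := X.action

/-- A `G`-set is transitive if it consists of exactly one orbit (so it is non-empty). -/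
def FinGSet.IsTransitive (X : FinGSet G) : Prop :=
  Nonempty X ∧ MulAction.IsPretransitive G X

variable (G) in
/-- The one-point `G`-set `𝟏`. -/
def FinGSet.one : FinGSet G where
  carrier := PUnit.{u + 1}
  action := { smul := fun _ x => x, one_smul := fun _ => rfl, mul_smul := fun _ _ _ => rfl }
  smooth x := by
    have h : ((@MulAction.stabilizer G PUnit.{u + 1} _
        { smul := fun _ x => x, one_smul := fun _ => rfl, mul_smul := fun _ _ _ => rfl } x :
        Subgroup G) : Set G) = Set.univ := Set.eq_univ_of_forall fun _ => rfl
    rw [h]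
    exact isOpen_univ
  finitary := @Quotient.finite PUnit.{u + 1} _ _

variable (G) in
theorem FinGSet.one_isTransitive : (FinGSet.one G).IsTransitive :=
  ⟨⟨PUnit.unit⟩, ⟨fun _ _ => ⟨1, rfl⟩⟩⟩

/-- The unique map `X → 𝟏`. -/
def FinGSet.toOne (X : FinGSet G) : X →[G] FinGSet.one G where
  toFun _ := PUnit.unit
  map_smul' _ _ := rfl

/-- A measure for the topological group `G` valued in the commutative ring `k`: a rule assigning
an element of `k` to each map `f : X → Y` of finitary `G`-sets with `Y` transitive. -/
@[ext]
structure GMeasure (G : Type u) [Group G] [TopologicalSpace G] (k : Type*) [CommRing k] where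
  val : ∀ {X Y : FinGSet G}, Y.IsTransitive → (X →[G] Y) → k
  /-- Isomorphisms have measure `1`. -/
  val_iso : ∀ {X Y : FinGSet G} (hY : Y.IsTransitive) (f : X →[G] Y),
    Function.Bijective f → val hY f = 1
  /-- Additivity for decompositions `X = X₁ ⨿ X₂`, given by the inclusions `i₁` and `i₂`. -/
  val_coprod : ∀ {X X₁ X₂ Y : FinGSet G} (hY : Y.IsTransitive) (f : X →[G] Y)
    (i₁ : X₁ →[G] X) (i₂ : X₂ →[G] X), Function.Bijective (Sum.elim i₁ i₂) →
    val hY f = val hY (f.comp i₁) + val hY (f.comp i₂)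
  /-- Multiplicativity for compositions. -/
  val_comp : ∀ {X Y Z : FinGSet G} (hY : Y.IsTransitive) (hZ : Z.IsTransitive)
    (g : Y →[G] Z) (f : X →[G] Y), val hZ (g.comp f) = val hZ g * val hY f
  /-- Invariance under base change: `f' : X' → Y'` is the base change of `f : X → Y` along
  `g : Y' → Y`, expressed by a cartesian square with top side `g' : X' → X`. -/
  val_baseChange : ∀ {X Y X' Y' : FinGSet G} (hY : Y.IsTransitive) (hY' : Y'.IsTransitive)
    (f : X →[G] Y) (g : Y' →[G] Y) (f' : X' →[G] Y') (g' : X' →[G] X),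
    (∀ x', f (g' x') = g (f' x')) →
    (∀ x y', f x = g y' → ∃! x', g' x' = x ∧ f' x' = y') →
    val hY' f' = val hY f

variable {k : Type*} [CommRing k]

/-- The measure of a finitary `G`-set `X` is the measure of the map `X → 𝟏`. -/
def GMeasure.ofSet (μ : GMeasure G k) (X : FinGSet G) : k :=
  μ.val (FinGSet.one_isTransitive G) X.toOne

/-- A measure is regular if its value on every map of transitive `G`-sets is a unit. -/
def GMeasure.IsRegular (μ : GMeasure G k) : Prop :=
  ∀ {X Y : FinGSet G} (_ : X.IsTransitive) (hY : Y.IsTransitive) (f : X →[G] Y),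
    IsUnit (μ.val hY f)

end GSets

section HomeoGroup

variable (𝔛 : Type u) [TopologicalSpace 𝔛]

variable {𝔛} in
/-- The subgroup `G{A}` of all self-homeomorphisms `g` with `g A = A`. -/
def setStab (A : Set 𝔛) : Subgroup (𝔛 ≃ₜ 𝔛) where
  carrier := {g | g '' A = A}
  one_mem' := Set.image_id A
  mul_mem' {g h} hg hh := by
    change (fun x => g (h x)) '' A = A
    rw [← Set.image_image g h, show h '' A = A from hh, show g '' A = A from hg]
  inv_mem' {g} hg := by
    change g.symm '' A = A
    conv_lhs => rw [← show g '' A = A from hg]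
    simp [Set.image_image]

/-- The collection of all subgroups `G{A₁} ∩ ⋯ ∩ G{Aₙ}` with `A₁, …, Aₙ` clopen. -/
def stabClass : Set (Subgroup (𝔛 ≃ₜ 𝔛)) :=
  {H | ∃ (n : ℕ) (A : Fin n → Set 𝔛), (∀ i, IsClopen (A i)) ∧ H = ⨅ i, setStab (A i)}

/-- The subgroups in `stabClass` form a basis of neighborhoods of the identity. -/
@[reducible]
def stabFilterBasis : GroupFilterBasis (𝔛 ≃ₜ 𝔛) where
  sets := {U | ∃ H ∈ stabClass 𝔛, U = (H : Set (𝔛 ≃ₜ 𝔛))}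
  nonempty := ⟨_, _, ⟨0, Fin.elim0, fun i => i.elim0, rfl⟩, rfl⟩
  inter_sets := by
    rintro _ _ ⟨_, ⟨m, A, hA, rfl⟩, rfl⟩ ⟨_, ⟨n, B, hB, rfl⟩, rfl⟩
    refine ⟨_, ⟨_, ⟨m + n, Fin.append A B, fun i => ?_, rfl⟩, rfl⟩, ?_⟩
    · refine Fin.addCases (fun i => ?_) (fun i => ?_) i
      · simpa using hA i
      · simpa using hB i
    · intro g hg
      simp only [SetLike.mem_coe, Subgroup.mem_iInf, Set.mem_inter_iff] at hg ⊢
      exact ⟨fun i => by simpa using hg (Fin.castAdd n i),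
        fun i => by simpa using hg (Fin.natAdd m i)⟩
  one' := by
    rintro _ ⟨H, _, rfl⟩
    exact H.one_mem
  mul' := by
    rintro _ ⟨H, hH, rfl⟩
    refine ⟨_, ⟨H, hH, rfl⟩, ?_⟩
    rintro _ ⟨a, ha, b, hb, rfl⟩
    exact H.mul_mem ha hb
  inv' := by
    rintro _ ⟨H, hH, rfl⟩
    exact ⟨_, ⟨H, hH, rfl⟩, fun a ha => H.inv_mem ha⟩
  conj' := by
    rintro g _ ⟨_, ⟨n, A, hA, rfl⟩, rfl⟩
    refine ⟨_, ⟨_, ⟨n, fun i => g ⁻¹' A i, fun i => (hA i).preimage g.continuous, rfl⟩, rfl⟩, ?_⟩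
    intro h hh
    simp only [SetLike.mem_coe, Subgroup.mem_iInf, Set.mem_preimage] at hh ⊢
    intro i
    have h1 : h '' (g ⁻¹' A i) = g ⁻¹' A i := hh i
    change (fun x => g (h (g.symm x))) '' A i = A i
    have h2 : g.symm '' A i = g ⁻¹' A i := g.symm.image_eq_preimage_symm (A i)
    rw [← Set.image_image (fun x => g (h x)) g.symm, ← Set.image_image g h, h2, h1]
    exact Set.image_preimage_eq _ g.surjective

/-- The group topology on the self-homeomorphisms of `𝔛` in which `stabClass` is a basis of
neighborhoods of the identity. -/
instance homeoTopology : TopologicalSpace (𝔛 ≃ₜ 𝔛) := (stabFilterBasis 𝔛).topology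

/-- The set `X(n)` of continuous surjections from `𝔛` onto the discrete space with `n` points. -/
def XSet (n : ℕ) : Type u := {φ : C(𝔛, Fin n) // Function.Surjective φ}

/-- The action of the self-homeomorphisms on `X(n)`: `g • φ = φ ∘ g⁻¹`. -/
instance (n : ℕ) : MulAction (𝔛 ≃ₜ 𝔛) (XSet 𝔛 n) where
  smul g φ := ⟨φ.1.comp ⟨g.symm, g.symm.continuous⟩, φ.2.comp g.symm.surjective⟩
  one_smul _ := rfl
  mul_smul _ _ _ := rfl

theorem XSet.smooth (n : ℕ) (φ : XSet 𝔛 n) :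
    IsOpen (MulAction.stabilizer (𝔛 ≃ₜ 𝔛) φ : Set (𝔛 ≃ₜ 𝔛)) := by
  have : IsTopologicalGroup (𝔛 ≃ₜ 𝔛) := (stabFilterBasis 𝔛).isTopologicalGroup
  let H : Subgroup (𝔛 ≃ₜ 𝔛) := ⨅ i : Fin n, setStab (φ.1 ⁻¹' {i})
  refine Subgroup.isOpen_of_mem_nhds (g := 1) _ (Filter.mem_of_superset
    ((stabFilterBasis 𝔛).mem_nhds_one (U := (H : Set (𝔛 ≃ₜ 𝔛))) ⟨H, ⟨n, _, fun i =>
      (isClopen_discrete {i}).preimage φ.1.continuous, rfl⟩, rfl⟩) ?_)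
  intro g hg
  have hg' : g⁻¹ ∈ H := H.inv_mem hg
  simp only [H, Subgroup.mem_iInf] at hg'
  refine Subtype.ext (ContinuousMap.ext fun x => ?_)
  have h1 : g.symm '' (φ.1 ⁻¹' {φ.1 x}) = φ.1 ⁻¹' {φ.1 x} := hg' (φ.1 x)
  have h2 : g.symm x ∈ φ.1 ⁻¹' {φ.1 x} := by
    rw [← h1]
    exact ⟨x, rfl, rfl⟩
  exact h2

end HomeoGroup

section Transitivity

/-- A Cantor space is a topological space homeomorphic to the Cantor set. -/
class IsCantorSpace (𝔛 : Type u) [TopologicalSpace 𝔛] : Prop where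
  homeo : Nonempty (𝔛 ≃ₜ cantorSet)

theorem fin_prod_cantor (k : ℕ) : Nonempty (Fin (k + 1) × (ℕ → Bool) ≃ₜ (ℕ → Bool)) := by
  induction k with
  | zero => exact ⟨Homeomorph.uniqueProd (Fin 1) (ℕ → Bool)⟩
  | succ k ih =>
    obtain ⟨e⟩ := ih
    let c := ℕ → Bool
    let d : Bool × c ≃ₜ c :=
      { toFun := fun p n => Nat.casesOn n p.1 p.2
        invFun := fun f => (f 0, fun n => f (n + 1))
        left_inv := fun p => rfl
        right_inv := fun f => by
          funext n
          cases n <;> rfl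
        continuous_toFun := by
          refine continuous_pi fun n => ?_
          cases n with
          | zero => exact continuous_fst
          | succ n => exact (continuous_apply n).comp continuous_snd
        continuous_invFun := by fun_prop }
    let e1 : Fin (k + 1 + 1) ≃ₜ Fin (k + 1) ⊕ Fin 1 :=
      (finSumFinEquiv (m := k + 1) (n := 1)).symm.toHomeomorphOfDiscrete
    let e2 : Bool ≃ₜ Unit ⊕ Unit := Equiv.boolEquivPUnitSumPUnit.toHomeomorphOfDiscrete
    let a : Fin (k + 1 + 1) × c ≃ₜ c ⊕ c :=
      (e1.prodCongr (Homeomorph.refl c)).trans (Homeomorph.sumProdDistrib.trans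
        (e.sumCongr (Homeomorph.uniqueProd (Fin 1) c)))
    let b : Bool × c ≃ₜ c ⊕ c :=
      (e2.prodCongr (Homeomorph.refl c)).trans (Homeomorph.sumProdDistrib.trans
        ((Homeomorph.uniqueProd Unit c).sumCongr (Homeomorph.uniqueProd Unit c)))
    exact ⟨a.trans (b.symm.trans d)⟩

theorem finite_prod_cantor (F : Type) [Finite F] [Nonempty F] [TopologicalSpace F]
    [DiscreteTopology F] : Nonempty (F × (ℕ → Bool) ≃ₜ (ℕ → Bool)) := by
  obtain ⟨n, ⟨e⟩⟩ := Finite.exists_equiv_fin F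
  cases n with
  | zero => exact (e (Classical.arbitrary F)).elim0
  | succ k =>
    obtain ⟨h⟩ := fin_prod_cantor k
    exact ⟨(e.toHomeomorphOfDiscrete.prodCongr (Homeomorph.refl _)).trans h⟩

theorem surj_finite_depth {n : ℕ} (φ : C(ℕ → Bool, Fin n)) :
    ∃ M : ℕ, ∀ x y : ℕ → Bool, (∀ i < M, x i = y i) → φ x = φ y := by
  have h : ∀ x : ℕ → Bool, ∃ m : ℕ, PiNat.cylinder x m ⊆ φ ⁻¹' {φ x} := by
    intro x
    have ho : IsOpen (φ ⁻¹' {φ x}) := (isOpen_discrete _).preimage φ.continuous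
    obtain ⟨_, ⟨y, m, rfl⟩, hx, hs⟩ :=
      (PiNat.isTopologicalBasis_cylinders (fun _ : ℕ => Bool)).exists_subset_of_mem_open
        (show x ∈ φ ⁻¹' {φ x} from rfl) ho
    exact ⟨m, by rwa [PiNat.mem_cylinder_iff_eq.1 hx]⟩
  choose m hm using h
  obtain ⟨t, -, ht⟩ := (isCompact_univ (X := ℕ → Bool)).elim_nhds_subcover
    (fun x => PiNat.cylinder x (m x))
    (fun x _ => (PiNat.isOpen_cylinder _ x (m x)).mem_nhds (PiNat.self_mem_cylinder x _))
  refine ⟨t.sup m, fun x y hxy => ?_⟩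
  obtain ⟨z, hz, hxz⟩ := Set.mem_iUnion₂.1 (ht (Set.mem_univ x))
  have hyz : y ∈ PiNat.cylinder z (m z) := by
    rw [PiNat.mem_cylinder_iff] at hxz ⊢
    intro i hi
    rw [← hxy i (hi.trans_le (Finset.le_sup hz)), hxz i hi]
  have h1 : φ x = φ z := hm z hxz
  have h2 : φ y = φ z := hm z hyz
  rw [h1, h2]

theorem surj_trivialize {n : ℕ} (φ : C(ℕ → Bool, Fin n)) (hφ : Function.Surjective φ) :
    ∃ h : (ℕ → Bool) ≃ₜ Fin n × (ℕ → Bool), ∀ x, (h x).1 = φ x := by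
  obtain ⟨M, hM⟩ := surj_finite_depth φ
  let U := Fin M → Bool
  let c := ℕ → Bool
  let e : c ≃ₜ U × c :=
    ((Homeomorph.piCongrLeft (Y := fun _ => Bool) (finSumNatEquiv M)).symm).trans
      Homeomorph.sumArrowHomeomorphProdArrow
  have he : ∀ x (i : Fin M), (e x).1 i = x i := fun x i => rfl
  let ψ : U → Fin n := fun u => φ (e.symm (u, fun _ => false))
  have hψ : ∀ x, ψ (e x).1 = φ x := by
    intro x
    refine hM _ _ fun i hi => ?_
    have := he (e.symm ((e x).1, fun _ => false)) ⟨i, hi⟩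
    rw [e.apply_symm_apply] at this
    exact this.symm
  have hne : ∀ i, Nonempty {u : U // ψ u = i} := by
    intro i
    obtain ⟨x, rfl⟩ := hφ i
    exact ⟨⟨_, hψ x⟩⟩
  have hk : ∀ i, Nonempty ({u : U // ψ u = i} × c ≃ₜ c) := fun i => by
    have := hne i
    exact finite_prod_cantor _
  let k := fun i => (hk i).some
  have key : ∀ i (q : {u : U // ψ u = i} × c),
      (ψ q.1.1, k (ψ q.1.1) (⟨q.1.1, rfl⟩, q.2)) = (i, k i q) := by
    rintro i ⟨⟨u, rfl⟩, x⟩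
    rfl
  let t : U × c ≃ₜ Fin n × c :=
    { toFun := fun p => (ψ p.1, k (ψ p.1) (⟨p.1, rfl⟩, p.2))
      invFun := fun p => (((k p.1).symm p.2).1.1, ((k p.1).symm p.2).2)
      left_inv := fun p => by simp
      right_inv := fun p => (key p.1 ((k p.1).symm p.2)).trans (by simp)
      continuous_toFun := by
        refine continuous_prod_of_discrete_left.2 fun u => ?_
        have : Continuous fun x : c => (ψ u, k (ψ u) (⟨u, rfl⟩, x)) := by fun_prop
        exact this
      continuous_invFun := by
        refine continuous_prod_of_discrete_left.2 fun i => ?_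
        have := (k i).symm.continuous
        exact (continuous_subtype_val.comp (continuous_fst.comp this)).prodMk
          (continuous_snd.comp this) }
  exact ⟨e.trans t, hψ⟩

theorem XSet.transitive (𝔛 : Type u) [TopologicalSpace 𝔛] [h𝔛 : IsCantorSpace 𝔛] (n : ℕ) :
    MulAction.IsPretransitive (𝔛 ≃ₜ 𝔛) (XSet 𝔛 n) := by
  obtain ⟨s0⟩ := h𝔛.homeo
  let s : 𝔛 ≃ₜ (ℕ → Bool) := s0.trans cantorSetHomeomorphNatToBool
  refine ⟨fun φ ψ => ?_⟩
  obtain ⟨a, ha⟩ := surj_trivialize (φ.1.comp ⟨s.symm, s.symm.continuous⟩)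
    (φ.2.comp s.symm.surjective)
  obtain ⟨b, hb⟩ := surj_trivialize (ψ.1.comp ⟨s.symm, s.symm.continuous⟩)
    (ψ.2.comp s.symm.surjective)
  refine ⟨s.trans (a.trans (b.symm.trans s.symm)), Subtype.ext (ContinuousMap.ext fun x => ?_)⟩
  change φ.1 (s.symm (a.symm (b (s x)))) = ψ.1 x
  have h1 := ha (a.symm (b (s x)))
  have h2 := hb (s x)
  simp only [Homeomorph.apply_symm_apply, ContinuousMap.comp_apply, ContinuousMap.coe_mk,
    Homeomorph.symm_apply_apply] at h1 h2
  rw [← h1, h2]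

end Transitivity

/-- The finitary `G`-set `X(n)`, where `G` is the group of self-homeomorphisms of the Cantor
space `𝔛`. -/
def X (𝔛 : Type u) [TopologicalSpace 𝔛] [IsCantorSpace 𝔛] (n : ℕ) : FinGSet (𝔛 ≃ₜ 𝔛) where
  carrier := XSet 𝔛 n
  action := inferInstance
  smooth := XSet.smooth 𝔛 n
  finitary := by
    have := XSet.transitive 𝔛 n
    have : Subsingleton (MulAction.orbitRel.Quotient (𝔛 ≃ₜ 𝔛) (XSet 𝔛 n)) :=
      (MulAction.pretransitive_iff_subsingleton_quotient _ _).1 this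
    infer_instance

end CantorMeas

/-! Write c for -2 or -1; the two cases are treated together through (c + 1)(c + 2) = 0.

Two facts about `G` drive both halves. A locally constant map to a finite set is determined up to
homeomorphism by its range (`exists_homeo_of_range_eq`). The stabilizer of a point of X(n) has no
finite orbits except fixed points (`fixed_of_finite_orbit`). An open subgroup U contains the
stabilizer of some ψ in X(n) whose U-translates are relabelings of ψ
(`exists_stabilizer_le_finite`), so every transitive set is a finite quotient of some X(n)
(`exists_cover`).

Existence: the stabilizer of a point of X(k+1) fixes as many points of X(m+1) as there are
surjections from k+1 to m+1 letters. These sequences in k are linearly independent, so some linear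
functional sends the m-th one to c^m; applied to fixed-point counts it gives the weight `wt`.
Weights are additive, and since finite orbits are fixed, a covering of degree d multiplies them by
d. The measure of A → B is wt A / wt B. Only base change is hard. Finite coverings reduce it to
fibre products of sets X(n), whose orbits are given by ranges, and it becomes an identity for the
sum of c^#R over amalgamations R of two relations (`sum_amalgamations`). It holds because (c+1)^m -
1 is always 0 or c.

Uniqueness: for a finite covering p : X(n) → B, each orbit of X(n) ×_B X(n) projects isomorphically
to X(n). So the measure of this fibre product is determined by that of X(n); base change then
determines μ(p), and hence μ(B). -/

namespace CantorMeas

/-! ### Locally constant maps up to homeomorphism. -/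

section Topology

variable {𝔛 : Type u} [TopologicalSpace 𝔛]

theorem XSet.smul_apply {n : ℕ} (g : 𝔛 ≃ₜ 𝔛) (φ : XSet 𝔛 n) (x : 𝔛) :
    (g • φ).1 x = φ.1 (g.symm x) := rfl

theorem XSet.ext {n : ℕ} {φ ψ : XSet 𝔛 n} (h : ∀ x, φ.1 x = ψ.1 x) : φ = ψ :=
  Subtype.ext (ContinuousMap.ext h)

theorem XSet.isLocallyConstant {n : ℕ} (φ : XSet 𝔛 n) : IsLocallyConstant φ.1 :=
  (IsLocallyConstant.iff_continuous _).2 φ.1.continuous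

/-- The point of `X(n)` given by a locally constant surjection. -/
def XSet.mk {n : ℕ} (α : 𝔛 → Fin n) (hα : IsLocallyConstant α) (hs : Function.Surjective α) :
    XSet 𝔛 n := ⟨⟨α, hα.continuous⟩, hs⟩

theorem isLocallyConstant_comp_symm {F : Type*} {α : 𝔛 → F} (hα : IsLocallyConstant α)
    (g : 𝔛 ≃ₜ 𝔛) : IsLocallyConstant fun x => α (g.symm x) :=
  hα.comp_continuous g.symm.continuous

theorem isLocallyConstant_of_comp_injective {F F' : Type*} {α : 𝔛 → F} (hα : IsLocallyConstant α)
    {f : 𝔛 → F'} {j : F' → F} (hj : Function.Injective j) (h : ∀ x, j (f x) = α x) :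
    IsLocallyConstant f :=
  IsLocallyConstant.desc f j ((funext h : j ∘ f = α) ▸ hα) hj

/-- A locally constant map to a finite set factors through a point of some `X(n)`. -/
theorem exists_factor {F : Type*} [Finite F] {α : 𝔛 → F} (hα : IsLocallyConstant α) :
    ∃ (n : ℕ) (ψ : XSet 𝔛 n) (j : Fin n → F), Function.Injective j ∧ ∀ x, j (ψ.1 x) = α x := by
  obtain ⟨n, ⟨e⟩⟩ := Finite.exists_equiv_fin (Set.range α)
  have hj : Function.Injective fun i => ((e.symm i : Set.range α) : F) :=
    Subtype.val_injective.comp e.symm.injective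
  have h : IsLocallyConstant (fun x => e ⟨α x, x, rfl⟩) :=
    isLocallyConstant_of_comp_injective hα hj fun x => by simp
  refine ⟨n, XSet.mk _ h ?_, fun i => (e.symm i : Set.range α), hj, fun x => ?_⟩
  · intro i
    obtain ⟨x, hx⟩ := (e.symm i).2
    exact ⟨x, by simp [hx]⟩
  · simp [XSet.mk]

variable [IsCantorSpace 𝔛]

/-- Two locally constant maps with the same finite range differ by a homeomorphism. -/
theorem exists_homeo_of_range_eq {F : Type*} [Finite F] {α β : 𝔛 → F} (hα : IsLocallyConstant α)
    (hβ : IsLocallyConstant β) (h : Set.range α = Set.range β) :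
    ∃ g : 𝔛 ≃ₜ 𝔛, ∀ x, α (g.symm x) = β x := by
  obtain ⟨n, ⟨e⟩⟩ := Finite.exists_equiv_fin (Set.range α)
  have key : ∀ (γ : 𝔛 → F) (hγ : IsLocallyConstant γ) (hr : Set.range α = Set.range γ),
      ∃ ψ : XSet 𝔛 n, ∀ x, ((e.symm (ψ.1 x) : Set.range α) : F) = γ x := by
    intro γ hγ hr
    have hmem : ∀ x, γ x ∈ Set.range α := fun x => hr ▸ ⟨x, rfl⟩
    have h : IsLocallyConstant (fun x => e ⟨γ x, hmem x⟩) :=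
      isLocallyConstant_of_comp_injective hγ (Subtype.val_injective.comp e.symm.injective)
        fun x => by simp
    refine ⟨XSet.mk _ h ?_, fun x => by simp [XSet.mk]⟩
    intro i
    obtain ⟨x, hx⟩ : ((e.symm i : Set.range α) : F) ∈ Set.range γ := hr ▸ (e.symm i).2
    exact ⟨x, by simp [hx]⟩
  obtain ⟨ψ, hψ⟩ := key α hα rfl
  obtain ⟨χ, hχ⟩ := key β hβ h
  have := XSet.transitive 𝔛 n
  obtain ⟨g, rfl⟩ := MulAction.exists_smul_eq (𝔛 ≃ₜ 𝔛) ψ χ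
  exact ⟨g, fun x => by rw [← hψ, ← hχ]; rfl⟩

theorem exists_isLocallyConstant_surjective (𝔛 : Type u) [TopologicalSpace 𝔛]
    [h𝔛 : IsCantorSpace 𝔛] (F : Type*) [Finite F] [Nonempty F] :
    ∃ θ : 𝔛 → F, IsLocallyConstant θ ∧ Function.Surjective θ := by
  obtain ⟨n, ⟨e⟩⟩ := Finite.exists_equiv_fin F
  have : Nonempty (Fin n) := e.nonempty_congr.1 inferInstance
  obtain ⟨s⟩ := h𝔛.homeo
  obtain ⟨h⟩ := finite_prod_cantor (Fin n)
  let t : 𝔛 ≃ₜ Fin n × (ℕ → Bool) := (s.trans cantorSetHomeomorphNatToBool).trans h.symm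
  refine ⟨fun x => e.symm (t x).1, IsLocallyConstant.comp (f := fun x => (t x).1) ?_ e.symm, ?_⟩
  · exact (IsLocallyConstant.iff_continuous _).2 (by fun_prop)
  · intro y
    exact ⟨t.symm (e y, fun _ => false), by simp⟩

theorem nonempty_XSet (𝔛 : Type u) [TopologicalSpace 𝔛] [IsCantorSpace 𝔛] (n : ℕ) :
    Nonempty (XSet 𝔛 (n + 1)) :=
  let ⟨θ, h, hs⟩ := exists_isLocallyConstant_surjective 𝔛 (Fin (n + 1))
  ⟨XSet.mk θ h hs⟩

instance : Nonempty 𝔛 :=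
  let ⟨_, _, hs⟩ := exists_isLocallyConstant_surjective 𝔛 Unit
  ⟨(hs ()).choose⟩

/-- Every fibre of a locally constant map can be subdivided into any finite number of parts. -/
theorem exists_subdivision {F : Type*} [Finite F] {α : 𝔛 → F} (hα : IsLocallyConstant α)
    (F' : Type*) [Finite F'] [Nonempty F'] :
    ∃ β : 𝔛 → F', IsLocallyConstant β ∧ ∀ x y, ∃ z, α z = α x ∧ β z = y := by
  have : Nonempty (Set.range α) := Set.range_nonempty α |>.to_subtype
  -- Transporting θ so that its first coordinate becomes α makes its second coordinate the required
  -- subdivision.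
  obtain ⟨θ, hθ, hs⟩ := exists_isLocallyConstant_surjective 𝔛 (Set.range α × F')
  obtain ⟨g, hg⟩ := exists_homeo_of_range_eq (α := fun x => ((θ x).1 : F)) (β := α)
    (hθ.comp fun p => (p.1 : F)) hα (by
      ext y
      constructor
      · rintro ⟨x, rfl⟩
        exact (θ x).1.2
      · rintro hy
        obtain ⟨x, hx⟩ := hs (⟨y, hy⟩, Classical.arbitrary F')
        exact ⟨x, by simp [hx]⟩)
  refine ⟨fun x => (θ (g.symm x)).2,
    (isLocallyConstant_comp_symm hθ g).comp Prod.snd, fun x y => ?_⟩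
  obtain ⟨z, hz⟩ := hs (⟨α x, x, rfl⟩, y)
  exact ⟨g z, by rw [← hg]; simp [hz], by simp [hz]⟩

/-- A locally constant map fixed by the stabilizer of `φ` factors through `φ`. -/
theorem exists_eq_comp_of_fixed {n : ℕ} (φ : XSet 𝔛 n) {F : Type*} [Finite F] {α : 𝔛 → F}
    (hα : IsLocallyConstant α)
    (h : ∀ g ∈ MulAction.stabilizer (𝔛 ≃ₜ 𝔛) φ, ∀ x, α (g.symm x) = α x) :
    ∃ s : Fin n → F, ∀ x, α x = s (φ.1 x) := by
  have key : ∀ x y, φ.1 x = φ.1 y → α x = α y := by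
    intro x y hxy
    classical
    let γ : 𝔛 → Fin n × F := fun z => (φ.1 z, α z)
    have hγ : IsLocallyConstant γ := φ.isLocallyConstant.prodMk hα
    -- The swap preserves the range of γ, and its first coordinate because φ x = φ y. It is thus
    -- realized by a homeomorphism g fixing φ, with α (g⁻¹ x) = α y.
    let e := Equiv.swap (γ x) (γ y)
    have he : ∀ z, (e (γ z)).1 = φ.1 z := by
      intro z
      simp only [e, Equiv.swap_apply_def]
      split_ifs with h1 h2
      · exact hxy.symm.trans (congrArg Prod.fst h1).symm
      · exact hxy.trans (congrArg Prod.fst h2).symm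
      · rfl
    obtain ⟨g, hg⟩ := exists_homeo_of_range_eq hγ (hγ.comp e) (by
      ext p
      simp only [Set.mem_range, Function.comp]
      constructor
      · rintro ⟨z, rfl⟩
        simp only [e, Equiv.swap_apply_def]
        by_cases h1 : γ z = γ x
        · exact ⟨y, by simp [h1]⟩
        · by_cases h2 : γ z = γ y
          · exact ⟨x, by simp [h2]⟩
          · exact ⟨z, by simp [h1, h2]⟩
      · rintro ⟨z, rfl⟩
        simp only [e, Equiv.swap_apply_def]
        split_ifs
        exacts [⟨y, rfl⟩, ⟨x, rfl⟩, ⟨z, rfl⟩])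
    have hgφ : g ∈ MulAction.stabilizer (𝔛 ≃ₜ 𝔛) φ :=
      XSet.ext fun z => (congrArg Prod.fst (hg z)).trans (he z)
    have h1 := congrArg Prod.snd (hg x)
    simp only [γ, Function.comp, e, Equiv.swap_apply_left] at h1
    rw [← h g hgφ x]
    exact h1
  exact ⟨fun i => α (φ.2 i).choose, fun x => key _ _ (φ.2 (φ.1 x)).choose_spec.symm⟩

/-! ### Open subgroups and their finite orbits. -/

omit [IsCantorSpace 𝔛] in
/-- Every open subgroup contains the stabilizer of a point of some `X(n)`. -/
theorem exists_stabilizer_le {U : Subgroup (𝔛 ≃ₜ 𝔛)} (hU : IsOpen (U : Set (𝔛 ≃ₜ 𝔛))) :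
    ∃ (n : ℕ) (ψ : XSet 𝔛 n), MulAction.stabilizer (𝔛 ≃ₜ 𝔛) ψ ≤ U := by
  obtain ⟨V, ⟨H, ⟨m, A, hA, rfl⟩, rfl⟩, hV⟩ := (stabFilterBasis 𝔛).nhds_one_hasBasis.mem_iff.1
    (hU.mem_nhds U.one_mem)
  have hα : IsLocallyConstant (fun x (i : Fin m) => x ∈ A i) := by
    rw [IsLocallyConstant.iff_eventually_eq]
    intro x
    have : ∀ i, ∀ᶠ y in nhds x, (y ∈ A i) = (x ∈ A i) := by
      intro i
      by_cases hx : x ∈ A i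
      · filter_upwards [(hA i).isOpen.mem_nhds hx] with y hy
        simp [hx, hy]
      · filter_upwards [(hA i).compl.isOpen.mem_nhds hx] with y hy
        simpa [hx] using hy
    filter_upwards [Filter.eventually_all.2 this] with y hy
    exact funext hy
  obtain ⟨n, ψ, j, -, hj⟩ := exists_factor hα
  refine ⟨n, ψ, fun g hg => hV ?_⟩
  refine Subgroup.mem_iInf.2 fun i => ?_
  change g '' A i = A i
  ext x
  have h1 : ψ.1 (g.symm x) = ψ.1 x := congrArg (fun θ : XSet 𝔛 n => θ.1 x) hg
  have h2 := congrFun ((hj (g.symm x)).symm.trans ((congrArg j h1).trans (hj x))) i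
  rw [g.image_eq_preimage_symm]
  exact iff_of_eq h2

omit [IsCantorSpace 𝔛] in
theorem mem_of_smul_eq {U : Subgroup (𝔛 ≃ₜ 𝔛)} {n : ℕ} {ψ : XSet 𝔛 n}
    (hψ : MulAction.stabilizer (𝔛 ≃ₜ 𝔛) ψ ≤ U) {a b : 𝔛 ≃ₜ 𝔛} (ha : a ∈ U)
    (h : ∀ x, ψ.1 (b.symm x) = ψ.1 (a.symm x)) : b ∈ U := by
  have h1 : b • ψ = a • ψ := XSet.ext h
  have h2 : a⁻¹ * b ∈ U := hψ (by rw [MulAction.mem_stabilizer_iff, mul_smul, h1, inv_smul_smul])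
  simpa using U.mul_mem ha h2

/-- If `U` contains the stabilizer of `ψ`, and some element of `U` moves `ψ` to a map that takes
one value at two points where `ψ` takes the values `i₁ ≠ i₂`, then some element of `U` moves `ψ`
to a map `χ` such that the pairs `(ψ, χ)` are those with equal entries or with entries
`i₁` and `i₂`. -/
theorem exists_mem_range_eq {U : Subgroup (𝔛 ≃ₜ 𝔛)} {n : ℕ} {ψ : XSet 𝔛 n}
    (hψ : MulAction.stabilizer (𝔛 ≃ₜ 𝔛) ψ ≤ U) {v : 𝔛 ≃ₜ 𝔛} (hv : v ∈ U) {x y : 𝔛}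
    (hxy : ψ.1 (v.symm x) = ψ.1 (v.symm y)) :
    ∃ g ∈ U, Set.range (fun z => (ψ.1 z, ψ.1 (g.symm z)))
      = {p | p.1 = p.2 ∨ p = (ψ.1 x, ψ.1 y) ∨ p = (ψ.1 y, ψ.1 x)} := by
  have hψ1 := ψ.isLocallyConstant
  have hψv := isLocallyConstant_comp_symm hψ1 v
  have hp := hψ1.prodMk hψv
  obtain ⟨β, hβ, hβs⟩ := exists_subdivision hp Bool
  simp only [Prod.mk.injEq] at hβs
  -- Inside the fibre of ψ ∘ v⁻¹ containing x and y, the values ψ x and ψ y are exchanged on one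
  -- half of each cell. The range of (ψ, ψ ∘ v⁻¹) is unchanged, so χ = ψ ∘ g⁻¹ with ψ ∘ (g v)⁻¹ = ψ
  -- ∘ v⁻¹. The swapped halves give the off-diagonal pairs, the others the diagonal.
  let χ : 𝔛 → Fin n := fun z =>
    if ψ.1 (v.symm z) = ψ.1 (v.symm x) ∧ β z = true then Equiv.swap (ψ.1 x) (ψ.1 y) (ψ.1 z)
    else ψ.1 z
  have hχ : IsLocallyConstant χ := (hp.prodMk hβ).comp fun q =>
    if q.1.2 = ψ.1 (v.symm x) ∧ q.2 = true then Equiv.swap (ψ.1 x) (ψ.1 y) q.1.1 else q.1.1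
  obtain ⟨g, hg⟩ := exists_homeo_of_range_eq hp (hχ.prodMk hψv) (by
    ext ⟨a, b⟩
    simp only [Set.mem_range, Prod.mk.injEq]
    constructor
    · rintro ⟨z, rfl, rfl⟩
      obtain ⟨z', ⟨h1, h2⟩, h3⟩ := hβs z false
      exact ⟨z', by simp [χ, h3, h1], h2⟩
    · rintro ⟨z, rfl, rfl⟩
      simp only [χ, Equiv.swap_apply_def]
      split_ifs with h1 h2 h3
      · exact ⟨y, rfl, by rw [h1.1, hxy]⟩
      · exact ⟨x, rfl, by rw [h1.1]⟩
      · exact ⟨z, rfl, rfl⟩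
      · exact ⟨z, rfl, rfl⟩)
  simp only [Prod.mk.injEq] at hg
  have hgv : g * v ∈ U := mem_of_smul_eq hψ hv fun z => (hg z).2
  refine ⟨g, by simpa using U.mul_mem hgv (U.inv_mem hv), ?_⟩
  ext ⟨a, b⟩
  simp only [Set.mem_range, Prod.mk.injEq, Set.mem_ofPred_eq, (hg _).1]
  constructor
  · rintro ⟨z, rfl, rfl⟩
    simp only [χ, Equiv.swap_apply_def]
    split_ifs with h1 h2 h3
    · exact Or.inr (Or.inl ⟨h2, rfl⟩)
    · exact Or.inr (Or.inr ⟨h3, rfl⟩)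
    · exact Or.inl rfl
    · exact Or.inl rfl
  · rintro (rfl | ⟨rfl, rfl⟩ | ⟨rfl, rfl⟩)
    · obtain ⟨z, rfl⟩ := ψ.2 a
      obtain ⟨z', ⟨h1, h2⟩, h3⟩ := hβs z false
      exact ⟨z', h1, by simp [χ, h3, h1]⟩
    · obtain ⟨z, ⟨h1, h2⟩, h3⟩ := hβs x true
      exact ⟨z, h1, by simp [χ, h3, h1, h2]⟩
    · obtain ⟨z, ⟨h1, h2⟩, h3⟩ := hβs y true
      exact ⟨z, h1, by simp [χ, h3, h1, h2, hxy]⟩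

/-- Recolouring by β only sees the merged map, which χ and ψ share, and β takes both values on each
fibre of χ. `mem_of_merge` uses this for χ = ψ and for χ = ψ ∘ h⁻¹. -/
theorem exists_split_iff {Z N : Type*} [DecidableEq N] {χ ψ : Z → N} {β : Z → Bool} {i₁ i₂ : N}
    (hs : Function.Surjective χ)
    (hm : ∀ z, (if χ z = i₂ then i₁ else χ z) = if ψ z = i₂ then i₁ else ψ z)
    (hb : ∀ z b, ∃ z', χ z' = χ z ∧ β z' = b) (a b : N) :
    (∃ z, χ z = a ∧ (if ψ z = i₁ ∨ ψ z = i₂ then (if β z = true then i₁ else i₂) else ψ z) = b) ↔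
      (a = b ∨ (a = i₁ ∧ b = i₂) ∨ (a = i₂ ∧ b = i₁)) := by
  have hω' : ∀ z, (if ψ z = i₁ ∨ ψ z = i₂ then (if β z = true then i₁ else i₂) else ψ z)
      = if χ z = i₁ ∨ χ z = i₂ then (if β z = true then i₁ else i₂) else χ z := by
    intro z
    have := hm z
    grind
  simp_rw [hω']
  constructor
  · rintro ⟨z, rfl, rfl⟩
    split_ifs with h1 h2 <;> grind
  · intro hab
    obtain ⟨z, rfl⟩ := hs a
    obtain ⟨z', h1, h2⟩ := hb z (decide (b = i₁))
    refine ⟨z', h1, ?_⟩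
    rw [h1, h2]
    rcases hab with h | ⟨h, h'⟩ | ⟨h, h'⟩ <;> by_cases hb1 : b = i₁ <;> simp_all

/-- In the situation of `exists_mem_range_eq`, the group `U` contains the stabilizer of the map
obtained from `ψ` by merging the values `i₁` and `i₂`. -/
theorem mem_of_merge {U : Subgroup (𝔛 ≃ₜ 𝔛)} {n : ℕ} {ψ : XSet 𝔛 n}
    (hψ : MulAction.stabilizer (𝔛 ≃ₜ 𝔛) ψ ≤ U) {g : 𝔛 ≃ₜ 𝔛} (hgU : g ∈ U) {i₁ i₂ : Fin n}
    (hg : Set.range (fun z => (ψ.1 z, ψ.1 (g.symm z)))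
      = {p | p.1 = p.2 ∨ p = (i₁, i₂) ∨ p = (i₂, i₁)})
    {h : 𝔛 ≃ₜ 𝔛}
    (hh : ∀ z, (if ψ.1 (h.symm z) = i₂ then i₁ else ψ.1 (h.symm z))
      = if ψ.1 z = i₂ then i₁ else ψ.1 z) : h ∈ U := by
  have hψ1 := ψ.isLocallyConstant
  have hψh := isLocallyConstant_comp_symm hψ1 h
  have hψg := isLocallyConstant_comp_symm hψ1 g
  have hp := hψ1.prodMk hψh
  obtain ⟨β, hβ, hβs⟩ := exists_subdivision hp Bool
  simp only [Prod.mk.injEq] at hβs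
  -- ω is a stepping stone from ψ to ψ ∘ h⁻¹: the pairs (ψ, ω) and (ω, ψ ∘ h⁻¹) both have the range
  -- of (ψ, ψ ∘ g⁻¹). So two moves, each conjugate to g by homeomorphisms, lead from ψ to ψ ∘ h⁻¹
  -- inside U.
  let ω : 𝔛 → Fin n := fun z =>
    if ψ.1 z = i₁ ∨ ψ.1 z = i₂ then (if β z = true then i₁ else i₂) else ψ.1 z
  have hω : IsLocallyConstant ω := (hψ1.prodMk hβ).comp fun q =>
    if q.1 = i₁ ∨ q.1 = i₂ then (if q.2 = true then i₁ else i₂) else q.1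
  have key1 := exists_split_iff (i₁ := i₁) (i₂ := i₂) (β := β) ψ.2 (fun _ => rfl) fun z b =>
    (hβs z b).imp fun z' hz' => ⟨hz'.1.1, hz'.2⟩
  have key2 := exists_split_iff (ψ.2.comp h.symm.surjective) hh fun z b =>
    (hβs z b).imp fun z' hz' => ⟨hz'.1.2, hz'.2⟩
  obtain ⟨g₁, hg₁⟩ := exists_homeo_of_range_eq (hψ1.prodMk hψg) (hψ1.prodMk hω) (by
    rw [hg]
    ext p
    simp only [Set.mem_ofPred_eq, Set.mem_range, Prod.ext_iff]
    exact (key1 p.1 p.2).symm)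
  obtain ⟨g₂, hg₂⟩ := exists_homeo_of_range_eq (hψ1.prodMk hψg) (hω.prodMk hψh) (by
    rw [hg]
    ext p
    have h1 := (exists_congr fun z => and_comm).trans (key2 p.2 p.1)
    simp only [Set.mem_ofPred_eq, Set.mem_range, Prod.ext_iff]
    rw [Iff.comm, eq_comm (a := p.1), and_comm (a := p.1 = i₁), and_comm (a := p.1 = i₂),
      or_comm (a := p.2 = i₂ ∧ _)]
    exact h1)
  simp only [Prod.mk.injEq] at hg₁ hg₂
  have h1 : g₁ ∈ U := mem_of_smul_eq hψ U.one_mem fun z => (hg₁ z).1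
  have h2 : g₂ ∈ U := mem_of_smul_eq hψ (U.mul_mem h1 hgU) fun z =>
    (hg₂ z).1.trans (hg₁ z).2.symm
  exact mem_of_smul_eq hψ (U.mul_mem h2 hgU) fun z => (hg₂ z).2.symm

/-- An open subgroup `U` contains the stabilizer of some `ψ` whose translates by `U` differ from
`ψ` by a permutation of the values. -/
theorem exists_stabilizer_le_finite {U : Subgroup (𝔛 ≃ₜ 𝔛)} (hU : IsOpen (U : Set (𝔛 ≃ₜ 𝔛))) :
    ∃ (n : ℕ) (ψ : XSet 𝔛 n), MulAction.stabilizer (𝔛 ≃ₜ 𝔛) ψ ≤ U ∧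
      ∀ u ∈ U, ∃ σ : Fin n → Fin n, ∀ x, ψ.1 (u.symm x) = σ (ψ.1 x) := by
  classical
  have hex := exists_stabilizer_le hU
  -- Take n minimal. If some element of U merged two values of ψ, then U would contain the
  -- stabilizer of a map with fewer values.
  obtain ⟨ψ, hψ⟩ := Nat.find_spec hex
  refine ⟨Nat.find hex, ψ, hψ, ?_⟩
  have key : ∀ v ∈ U, ∀ x y, ψ.1 (v.symm x) = ψ.1 (v.symm y) → ψ.1 x = ψ.1 y := by
    intro v hv x y hxy
    by_contra hne
    obtain ⟨g, hgU, hg⟩ := exists_mem_range_eq hψ hv hxy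
    obtain ⟨n', ψ', j, hj, hjψ⟩ := exists_factor (ψ.isLocallyConstant.comp
      fun i => if i = ψ.1 y then ψ.1 x else i)
    simp only [Function.comp] at hjψ
    refine Nat.find_min hex (m := n') ?_ ⟨ψ', fun h hh => mem_of_merge hψ hgU hg fun z => ?_⟩
    · have hlt := Fintype.card_lt_of_injective_not_surjective j hj (fun hs => ?_)
      · simpa using hlt
      · obtain ⟨k, hk⟩ := hs (ψ.1 y)
        obtain ⟨z, rfl⟩ := ψ'.2 k
        rw [hjψ] at hk
        split_ifs at hk with h1
        · exact hne hk
        · exact h1 hk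
    · rw [← hjψ, ← hjψ]
      exact congrArg (fun θ : XSet 𝔛 n' => j (θ.1 z)) hh
  intro u hu
  refine ⟨fun i => ψ.1 (u.symm (ψ.2 i).choose), fun x => ?_⟩
  -- Applied to u⁻¹, `key` says that ψ x determines ψ (u⁻¹ x).
  refine key u⁻¹ (U.inv_mem hu) _ _ ?_
  change ψ.1 (u (u.symm x)) = ψ.1 (u (u.symm _))
  rw [u.apply_symm_apply, u.apply_symm_apply]
  exact (ψ.2 (ψ.1 x)).choose_spec.symm

/-- The stabilizer of a point of `X(k)` has no non-trivial finite orbits. -/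
theorem fixed_of_finite_orbit {E : Type*} [MulAction (𝔛 ≃ₜ 𝔛) E] {k : ℕ} (φ : XSet 𝔛 k) (e : E)
    (he : IsOpen (MulAction.stabilizer (𝔛 ≃ₜ 𝔛) e : Set (𝔛 ≃ₜ 𝔛)))
    (hfin : {y | ∃ h ∈ MulAction.stabilizer (𝔛 ≃ₜ 𝔛) φ, h • e = y}.Finite) :
    ∀ h ∈ MulAction.stabilizer (𝔛 ≃ₜ 𝔛) φ, h • e = e := by
  let U := MulAction.stabilizer (𝔛 ≃ₜ 𝔛) φ ⊓ MulAction.stabilizer (𝔛 ≃ₜ 𝔛) e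
  obtain ⟨n, ψ, hψ, hσ⟩ := exists_stabilizer_le_finite (U := U) ((XSet.smooth 𝔛 k φ).inter he)
  have hψφ := hψ.trans inf_le_left
  obtain ⟨s, hs⟩ := exists_eq_comp_of_fixed ψ φ.isLocallyConstant fun g hg x =>
    congrArg (fun θ : XSet 𝔛 k => θ.1 x) (hψφ hg)
  have hinj : Function.Injective s := by
    intro i₁ i₂ hi
    by_contra hne
    -- If s i₁ = s i₂, recolouring the merged fibre by any of r independent bits keeps φ fixed. With
    -- r larger than the orbit of e, two such moves agree on e, so they differ by an element of U
    -- and one recolouring is a function of the other.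
    obtain ⟨r, hr⟩ : ∃ r, hfin.toFinset.card < r := exists_gt _
    obtain ⟨β, hβ, hβs⟩ := exists_subdivision ψ.isLocallyConstant (Fin r → Bool)
    let χ : Fin r → 𝔛 → Fin n := fun a z =>
      if ψ.1 z = i₁ ∨ ψ.1 z = i₂ then (if β z a = true then i₁ else i₂) else ψ.1 z
    have hχ : ∀ a, IsLocallyConstant (χ a) := fun a => (ψ.isLocallyConstant.prodMk hβ).comp
      fun q => if q.1 = i₁ ∨ q.1 = i₂ then (if q.2 a = true then i₁ else i₂) else q.1
    have hχs : ∀ a, Function.Surjective (χ a) := by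
      intro a i
      obtain ⟨x, hx⟩ := ψ.2 i
      obtain ⟨z, hz, hz'⟩ := hβs x fun _ => decide (i = i₁)
      refine ⟨z, ?_⟩
      simp only [χ, hz, hz', hx]
      grind
    have hg : ∀ a, ∃ g : 𝔛 ≃ₜ 𝔛, ∀ x, ψ.1 (g.symm x) = χ a x := fun a =>
      exists_homeo_of_range_eq ψ.isLocallyConstant (hχ a)
        (ψ.2.range_eq.trans (hχs a).range_eq.symm)
    choose g hg using hg
    have hgφ : ∀ a, g a ∈ MulAction.stabilizer (𝔛 ≃ₜ 𝔛) φ := by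
      intro a
      refine XSet.ext fun x => ?_
      rw [XSet.smul_apply, hs, hs, hg]
      simp only [χ]
      grind
    obtain ⟨a, -, b, -, hab, he'⟩ := Finset.exists_ne_map_eq_of_card_lt_of_maps_to
      (s := (Finset.univ : Finset (Fin r))) (t := hfin.toFinset) (f := fun a => g a • e)
      (by simpa using hr) (fun a _ => by simpa using ⟨g a, hgφ a, rfl⟩)
    have hu : (g a)⁻¹ * g b ∈ U := by
      refine ⟨Subgroup.mul_mem _ (Subgroup.inv_mem _ (hgφ a)) (hgφ b), ?_⟩
      change ((g a)⁻¹ * g b) • e = e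
      rw [mul_smul, ← he', inv_smul_smul]
    obtain ⟨σ, hσ⟩ := hσ _ hu
    have hχσ : ∀ x, χ b x = σ (χ a x) := by
      intro x
      rw [← hg, ← hg, ← hσ]
      change _ = ψ.1 ((g b).symm (g a ((g a).symm x)))
      rw [Homeomorph.apply_symm_apply]
    obtain ⟨x₀, hx₀⟩ := ψ.2 i₁
    obtain ⟨x, hx, hx'⟩ := hβs x₀ fun _ => true
    -- x has all bits true and y only bit a: χ a agrees at x and y, while χ b does not.
    obtain ⟨y, hy, hy'⟩ := hβs x₀ fun c => decide (c = a)
    have h1 := hχσ x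
    have h2 := hχσ y
    simp only [χ, hx, hy, hx₀, hx', hy'] at h1 h2
    simp [hab.symm] at h1 h2
    exact hne (h1.trans h2.symm)
  intro h hh
  -- As s is injective, φ and ψ = s⁻¹ ∘ φ have the same stabilizer.
  have hle : MulAction.stabilizer (𝔛 ≃ₜ 𝔛) φ ≤ U := by
    intro g hg
    refine hψ (XSet.ext fun x => hinj ?_)
    rw [XSet.smul_apply, ← hs, ← hs]
    exact congrArg (fun θ : XSet 𝔛 k => θ.1 x) hg
  exact (hle hh).2

end Topology

/-! ### The amalgamation identity. -/

section Combinatorics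

open Finset

set_option linter.unusedSectionVars false

variable {I J K : Type*} [Fintype I] [Fintype J] [Fintype K] [DecidableEq I] [DecidableEq J]
  [DecidableEq K]

/-- The families `ρ` of non-empty subsets `ρ j` of the fibres of `s` over `t j`. -/
def fiberFamilies (s : I → K) (t : J → K) : Finset (J → Finset I) :=
  Fintype.piFinset fun j => (univ.filter fun i => s i = t j).powerset.erase ∅

/-- The sum of `c ^ (∑ j, #(ρ j))` over the families `ρ` in `fiberFamilies` with union `A`. -/
def familySum (c : ℚ) (s : I → K) (t : J → K) (A : Finset I) : ℚ :=
  ∑ ρ ∈ (fiberFamilies s t).filter (fun ρ => univ.biUnion ρ = A), ∏ j, c ^ #(ρ j)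

/-- Summing over all unions inside A frees the sets ρ j from each other. The non-empty subsets of an
m-element set contribute (c + 1)^m - 1 by the binomial theorem. -/
theorem sum_familySum (c : ℚ) (s : I → K) (t : J → K) (A : Finset I) :
    ∑ B ∈ A.powerset, familySum c s t B
      = ∏ j, ((c + 1) ^ #(A.filter fun i => s i = t j) - 1) := by
  have h1 : ∀ j, ((c + 1) ^ #(A.filter fun i => s i = t j) - 1)
      = ∑ r ∈ (A.filter fun i => s i = t j).powerset.erase ∅, c ^ #r := by
    intro j
    have := Finset.sum_pow_mul_eq_add_pow c 1 (A.filter fun i => s i = t j)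
    rw [← this, ← Finset.add_sum_erase _ _ (Finset.empty_mem_powerset _)]
    simp
  simp_rw [h1]
  rw [Finset.prod_univ_sum]
  unfold familySum
  rw [Finset.sum_sigma']
  refine Finset.sum_bij' (fun x _ => x.2) (fun ρ _ => ⟨univ.biUnion ρ, ρ⟩) ?_ ?_ ?_ ?_ ?_
  · rintro ⟨B, ρ⟩ h
    simp only [fiberFamilies, mem_sigma, mem_powerset, mem_filter, Fintype.mem_piFinset,
      mem_erase] at h ⊢
    obtain ⟨hB, h, rfl⟩ := h
    refine fun j => ⟨(h j).1, fun i hi => ?_⟩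
    have := (h j).2 hi
    simp only [mem_filter, mem_univ, true_and] at this ⊢
    exact ⟨hB (mem_biUnion.2 ⟨j, mem_univ _, hi⟩), this⟩
  · intro ρ h
    simp only [fiberFamilies, mem_sigma, mem_powerset, mem_filter, Fintype.mem_piFinset,
      mem_erase, and_true] at h ⊢
    refine ⟨fun i hi => ?_, fun j => ⟨(h j).1, fun i hi => ?_⟩⟩
    · obtain ⟨j, -, hj⟩ := mem_biUnion.1 hi
      exact (mem_filter.1 ((h j).2 hj)).1
    · simpa using (mem_filter.1 ((h j).2 hi)).2
  · rintro ⟨B, ρ⟩ h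
    simp only [mem_sigma, mem_filter] at h
    obtain ⟨hB, h, rfl⟩ := h
    rfl
  · intro ρ h
    rfl
  · intro x h
    rfl

theorem eq_of_sum_powerset_eq {f g : Finset I → ℚ}
    (h : ∀ A : Finset I, ∑ B ∈ A.powerset, f B = ∑ B ∈ A.powerset, g B) : f = g := by
  funext A
  induction A using Finset.strongInduction with
  | H A ih =>
    have := h A
    rw [← Finset.add_sum_erase _ _ (Finset.mem_powerset_self A),
      ← Finset.add_sum_erase _ _ (Finset.mem_powerset_self A)] at this
    rw [Finset.sum_congr rfl fun B hB => ih B ?_] at this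
    · exact add_right_cancel this
    · rw [mem_erase, mem_powerset] at hB
      exact hB.2.ssubset_of_ne hB.1

/-- The only place where the two values of c matter: c + 1 is 0 or -1, so its powers are 1 or c + 1.
-/
theorem pow_sub_one_eq {c : ℚ} (hc : (c + 1) * (c + 2) = 0) (m : ℕ) :
    (c + 1) ^ m - 1 = 0 ∨ (c + 1) ^ m - 1 = c := by
  rcases mul_eq_zero.1 hc with h | h
  · rcases m with _ | m
    · simp
    · right
      rw [h]
      simp
      linarith
  · have h1 : c + 1 = -1 := by linarith
    rw [h1]
    rcases neg_one_pow_eq_or ℚ m with h2 | h2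
    · left
      rw [h2]; ring
    · right
      rw [h2]; linarith

/-- Each factor in `sum_familySum` is 0 or c, so the product is a power of c unless a factor
vanishes. Since t is surjective, a factor vanishes over J exactly when one vanishes over K.
Inversion over subsets then compares the individual terms. -/
theorem familySum_id {c : ℚ} (hc : (c + 1) * (c + 2) = 0) (s : I → K) (t : J → K)
    (ht : Function.Surjective t) (A : Finset I) :
    c ^ Fintype.card K * familySum c s t A = c ^ Fintype.card J * familySum c s id A := by
  have hfun := eq_of_sum_powerset_eq
    (f := fun A => c ^ Fintype.card K * familySum c s t A)
    (g := fun A => c ^ Fintype.card J * familySum c s id A) (fun A => ?_)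
  · exact congrFun hfun A
  · rw [← Finset.mul_sum, ← Finset.mul_sum, sum_familySum, sum_familySum]
    by_cases h : ∀ k, (c + 1) ^ #(A.filter fun i => s i = k) - 1 = c
    · simp_rw [h]
      simp [mul_comm]
    · push Not at h
      obtain ⟨k, hk⟩ := h
      have hk0 := (pow_sub_one_eq hc _).resolve_right hk
      obtain ⟨j, rfl⟩ := ht k
      rw [Finset.prod_eq_zero (mem_univ j) hk0, Finset.prod_eq_zero (mem_univ (t j)) hk0]
      simp

/-- For t = id the sets ρ k lie in disjoint fibres of s, so their union is everything only when each
is a whole fibre. -/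
theorem familySum_id_univ (c : ℚ) (s : I → K) (hs : Function.Surjective s) :
    familySum c s id univ = c ^ Fintype.card I := by
  unfold familySum
  have : (fiberFamilies s id).filter (fun ρ : K → Finset I => univ.biUnion ρ = univ)
      = {fun k => univ.filter fun i => s i = k} := by
    ext ρ
    simp only [fiberFamilies, mem_filter, Fintype.mem_piFinset, mem_erase, mem_powerset,
      mem_singleton, id]
    constructor
    · rintro ⟨h, hu⟩
      funext k
      refine Finset.Subset.antisymm (h k).2 fun i hi => ?_
      have : i ∈ univ.biUnion ρ := hu ▸ mem_univ i
      obtain ⟨k', -, hk'⟩ := mem_biUnion.1 this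
      have h1 := (mem_filter.1 ((h k').2 hk')).2
      have h2 := (mem_filter.1 hi).2
      rwa [← h2, h1]
    · rintro rfl
      refine ⟨fun k => ⟨?_, subset_rfl⟩, ?_⟩
      · obtain ⟨i, rfl⟩ := hs k
        exact Finset.ne_empty_of_mem (a := i) (by simp)
      · ext i
        simp
  rw [this, Finset.sum_singleton, Finset.prod_pow_eq_pow_sum, ← Finset.card_univ,
    Finset.card_eq_sum_card_fiberwise (f := s) (t := univ) (fun _ _ => mem_univ _)]

theorem familySum_univ {c : ℚ} (hc : (c + 1) * (c + 2) = 0) (s : I → K) (t : J → K)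
    (hs : Function.Surjective s) (ht : Function.Surjective t) :
    c ^ Fintype.card K * familySum c s t univ = c ^ Fintype.card J * c ^ Fintype.card I := by
  rw [familySum_id hc s t ht, familySum_id_univ c s hs]

/-- The sum of `c ^ #R` over the amalgamations `R` of relations `P` and `Q` over `γ`. -/
theorem sum_amalgamations {c : ℚ} (hc : (c + 1) * (c + 2) = 0) {α β γ : Type*} [Fintype α]
    [Fintype β] [Fintype γ] [DecidableEq α] [DecidableEq β] [DecidableEq γ]
    (P : Finset (α × γ)) (Q : Finset (β × γ)) (hP : ∀ k, ∃ i, (i, k) ∈ P)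
    (hQ : ∀ k, ∃ j, (j, k) ∈ Q) :
    c ^ Fintype.card γ * ∑ R ∈ (univ : Finset (Finset (α × β × γ))).filter
      (fun R => R.image (fun x => (x.1, x.2.2)) = P ∧ R.image (fun x => x.2) = Q), c ^ #R
      = c ^ #P * c ^ #Q := by
  have key := familySum_univ hc (fun i : P => i.1.2) (fun j : Q => j.1.2)
    (fun k => (hP k).elim fun i hi => ⟨⟨_, hi⟩, rfl⟩)
    (fun k => (hQ k).elim fun i hi => ⟨⟨_, hi⟩, rfl⟩)
  rw [Fintype.card_coe, Fintype.card_coe] at key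
  rw [mul_comm (c ^ #P), ← key]
  congr 1
  unfold familySum
  -- An amalgamation R corresponds to the family sending j in Q to the elements of P that R joins to
  -- j. Projecting onto Q means that the members are non-empty; projecting onto P means that their
  -- union is P.
  refine Finset.sum_bij'
    (fun R _ => fun j : Q => univ.filter fun i : P => (i.1.1, j.1.1, j.1.2) ∈ R ∧ i.1.2 = j.1.2)
    (fun ρ _ => univ.filter fun x => ∃ (hp : (x.1, x.2.2) ∈ P) (hq : x.2 ∈ Q),
      (⟨_, hp⟩ : P) ∈ ρ ⟨_, hq⟩) ?_ ?_ ?_ ?_ ?_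
  · intro R hR
    obtain ⟨rfl, rfl⟩ := (mem_filter.1 hR).2
    simp only [fiberFamilies, mem_filter, Fintype.mem_piFinset, mem_erase, mem_powerset]
    refine ⟨fun j => ⟨?_, ?_⟩, ?_⟩
    · obtain ⟨⟨j, k⟩, hj⟩ := j
      obtain ⟨⟨i, j', k'⟩, hx, h⟩ := mem_image.1 hj
      obtain ⟨rfl, rfl⟩ := Prod.mk.injEq .. ▸ h
      exact Finset.ne_empty_of_mem (a := ⟨(i, k'), mem_image_of_mem (fun x => (x.1, x.2.2)) hx⟩)
        (by simpa using hx)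
    · intro i hi
      simp only [mem_filter, mem_univ, true_and] at hi ⊢
      exact hi.2
    · ext ⟨⟨i, k⟩, hi⟩
      obtain ⟨⟨i', j, k'⟩, hx, h⟩ := mem_image.1 hi
      obtain ⟨rfl, rfl⟩ := Prod.mk.injEq .. ▸ h
      simp only [mem_biUnion, mem_univ, mem_filter, true_and, iff_true]
      exact ⟨⟨(j, k'), mem_image_of_mem (fun x => x.2) hx⟩, hx, rfl⟩
  · intro ρ hρ
    simp only [fiberFamilies, mem_filter, Fintype.mem_piFinset, mem_erase, mem_powerset] at hρ
    obtain ⟨h, hu⟩ := hρ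
    simp only [mem_filter, mem_univ, true_and]
    constructor
    · ext ⟨i, k⟩
      simp only [mem_image, mem_filter, mem_univ, true_and]
      constructor
      · rintro ⟨x, ⟨hp, hq, hx⟩, hxe⟩
        rwa [← hxe]
      · intro hp
        have : (⟨(i, k), hp⟩ : P) ∈ univ.biUnion ρ := hu ▸ mem_univ _
        obtain ⟨⟨⟨j, k'⟩, hq⟩, -, hj⟩ := mem_biUnion.1 this
        have h1 := (mem_filter.1 ((h _).2 hj)).2
        simp only at h1
        subst h1
        exact ⟨(i, j, k), ⟨hp, hq, hj⟩, rfl⟩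
    · ext ⟨j, k⟩
      simp only [mem_image, mem_filter, mem_univ, true_and]
      constructor
      · rintro ⟨x, ⟨hp, hq, hx⟩, hxe⟩
        rwa [← hxe]
      · intro hq
        obtain ⟨⟨⟨i, k'⟩, hp⟩, hi⟩ := Finset.nonempty_iff_ne_empty.2 (h ⟨(j, k), hq⟩).1
        have h1 := (mem_filter.1 ((h _).2 hi)).2
        simp only at h1
        subst h1
        exact ⟨(i, j, k'), ⟨hp, hq, hi⟩, rfl⟩
  · intro R hR
    obtain ⟨rfl, rfl⟩ := (mem_filter.1 hR).2
    ext ⟨i, j, k⟩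
    simp only [mem_filter, mem_univ, true_and]
    constructor
    · rintro ⟨hp, hq, hx, -⟩
      exact hx
    · intro hx
      exact ⟨mem_image_of_mem (fun x : α × β × γ => (x.1, x.2.2)) hx,
        mem_image_of_mem (fun x : α × β × γ => x.2) hx, hx, trivial⟩
  · intro ρ hρ
    simp only [fiberFamilies, mem_filter, Fintype.mem_piFinset, mem_erase, mem_powerset] at hρ
    obtain ⟨h, hu⟩ := hρ
    funext ⟨⟨j, k⟩, hq⟩
    ext ⟨⟨i, k'⟩, hp⟩
    simp only [mem_filter, mem_univ, true_and]
    constructor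
    · rintro ⟨⟨hp', hq', hx⟩, hk⟩
      subst hk
      exact hx
    · intro hx
      have h1 := (mem_filter.1 ((h _).2 hx)).2
      simp only at h1
      subst h1
      exact ⟨⟨hp, hq, hx⟩, rfl⟩
  · intro R hR
    obtain ⟨rfl, rfl⟩ := (mem_filter.1 hR).2
    rw [Finset.prod_pow_eq_pow_sum]
    congr 1
    rw [Finset.card_eq_sum_card_image (fun x => x.2) R, ← Finset.sum_coe_sort]
    refine Finset.sum_congr rfl fun j _ => ?_
    refine Finset.card_bij (fun (x : α × β × γ) hx => ⟨(x.1, x.2.2),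
      mem_image_of_mem (fun x => (x.1, x.2.2)) (mem_filter.1 hx).1⟩) ?_ ?_ ?_
    · rintro ⟨i, j', k⟩ hx
      obtain ⟨hx, hxj⟩ := mem_filter.1 hx
      simp only [mem_filter, mem_univ, true_and]
      rw [← hxj]
      exact ⟨hx, rfl⟩
    · rintro ⟨i, j', k⟩ hx ⟨i', j'', k'⟩ hx' he
      have h1 := (mem_filter.1 hx).2
      have h2 := (mem_filter.1 hx').2
      simp only [Subtype.mk.injEq, Prod.mk.injEq] at he h1 h2
      rw [he.1, h1, h2]
    · rintro ⟨⟨i, k⟩, hp⟩ hx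
      obtain ⟨hx, hk⟩ := (mem_filter.1 hx).2
      simp only at hx hk
      subst hk
      exact ⟨(i, j.1), mem_filter.2 ⟨by simpa using hx, rfl⟩, rfl⟩

end Combinatorics

/-! ### Surjection counts and the functional on sequences. -/

/-- The number of surjections from a set with `k + 1` elements to a set with `m + 1` elements. -/
noncomputable def surjCount (m k : ℕ) : ℕ :=
  Nat.card {f : Fin (k + 1) → Fin (m + 1) // Function.Surjective f}

theorem surjCount_of_lt {m k : ℕ} (h : k < m) : surjCount m k = 0 := by
  have : IsEmpty {f : Fin (k + 1) → Fin (m + 1) // Function.Surjective f} :=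
    ⟨fun f => by simpa [h.not_ge] using Fintype.card_le_of_surjective f.1 f.2⟩
  exact Nat.card_of_isEmpty

theorem surjCount_self (m : ℕ) : surjCount m m ≠ 0 := by
  have : Nonempty {f : Fin (m + 1) → Fin (m + 1) // Function.Surjective f} :=
    ⟨⟨id, Function.surjective_id⟩⟩
  exact Nat.card_pos.ne'

/-- The array is triangular with non-zero diagonal. -/
theorem linearIndependent_surjCount :
    LinearIndependent ℚ (fun m k : ℕ => (surjCount m k : ℚ)) := by
  rw [linearIndependent_iff']
  intro s g h m
  induction m using Nat.strong_induction_on with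
  | _ m ih =>
    intro hm
    have h1 := congrFun h m
    rw [Finset.sum_apply, Finset.sum_eq_single_of_mem m hm] at h1
    · simpa [surjCount_self] using h1
    · intro b hb hbm
      rcases lt_or_gt_of_ne hbm with h2 | h2
      · simp [ih b h2 hb]
      · simp [surjCount_of_lt h2]

theorem exists_surjCount_functional (c : ℚ) :
    ∃ L : (ℕ → ℚ) →ₗ[ℚ] ℚ, ∀ m, L (fun k => (surjCount m k : ℚ)) = c ^ m := by
  obtain ⟨L, hL⟩ := LinearMap.exists_extend
    ((Module.Basis.span linearIndependent_surjCount).constr ℚ (fun m => c ^ m))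
  refine ⟨L, fun m => ?_⟩
  have h1 := LinearMap.congr_fun hL (Module.Basis.span linearIndependent_surjCount m)
  rw [Module.Basis.constr_basis] at h1
  rw [← h1, LinearMap.comp_apply, Submodule.subtype_apply, Module.Basis.span_apply]

/-- A linear functional taking the sequence `k ↦ surjCount m k` to `c ^ m`. -/
noncomputable def surjFunctional (c : ℚ) : (ℕ → ℚ) →ₗ[ℚ] ℚ :=
  (exists_surjCount_functional c).choose

theorem surjFunctional_surjCount (c : ℚ) (m : ℕ) :
    surjFunctional c (fun k => (surjCount m k : ℚ)) = c ^ m :=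
  (exists_surjCount_functional c).choose_spec m

/-! ### Weights, finite coverings and evaluations. -/

section Weights

variable (𝔛 : Type u) [TopologicalSpace 𝔛] [IsCantorSpace 𝔛]

/-- A point of `X(k + 1)`. -/
noncomputable def basePoint (k : ℕ) : XSet 𝔛 (k + 1) := (nonempty_XSet 𝔛 k).some

variable {E B : Type*} [MulAction (𝔛 ≃ₜ 𝔛) E] [MulAction (𝔛 ≃ₜ 𝔛) B]

/-- The points of `S` that are fixed by the stabilizer of the base point of `X(k + 1)`. -/
def fixedIn (S : Set E) (k : ℕ) : Set E :=
  {e | e ∈ S ∧ ∀ h ∈ MulAction.stabilizer (𝔛 ≃ₜ 𝔛) (basePoint 𝔛 k), h • e = e}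

/-- The weight of a set `S` in a `G`-set, read off from the numbers of fixed points in `S` of the
stabilizers of the base points of the `X(k)`. -/
noncomputable def wt (c : ℚ) (S : Set E) : ℚ :=
  surjFunctional c fun k => ((fixedIn 𝔛 S k).ncard : ℚ)

variable {𝔛}

/-- Finiteness is required because `Set.ncard` is 0 on infinite sets, which would break additivity.
-/
theorem wt_eq_sum {ι : Type*} [Fintype ι] (c : ℚ) (π : E → ι) (S : Set E)
    (hfin : ∀ k, (fixedIn 𝔛 S k).Finite) :
    wt 𝔛 c S = ∑ i, wt 𝔛 c {e | e ∈ S ∧ π e = i} := by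
  classical
  unfold wt
  rw [← map_sum]
  congr 1
  funext k
  rw [Finset.sum_apply]
  rw [Set.ncard_eq_toFinset_card _ (hfin k), Finset.card_eq_sum_card_fiberwise (f := π)
    (t := Finset.univ) (fun _ _ => Finset.mem_univ _), Nat.cast_sum]
  refine Finset.sum_congr rfl fun i _ => ?_
  rw [← Set.ncard_coe_finset]
  congr 2
  ext e
  simp only [fixedIn, Finset.coe_filter, Set.Finite.mem_toFinset, Set.mem_ofPred_eq]
  tauto

theorem wt_image {c : ℚ} {p : E → B} (hp : ∀ (g : 𝔛 ≃ₜ 𝔛) e, p (g • e) = g • p e)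
    (hinj : Function.Injective p) (S : Set E) : wt 𝔛 c (p '' S) = wt 𝔛 c S := by
  unfold wt
  congr 1
  funext k
  have : fixedIn 𝔛 (p '' S) k = p '' fixedIn 𝔛 S k := by
    ext b
    constructor
    · rintro ⟨⟨e, he, rfl⟩, h⟩
      exact ⟨e, ⟨he, fun g hg => hinj ((hp g e).trans (h g hg))⟩, rfl⟩
    · rintro ⟨e, ⟨he, h⟩, rfl⟩
      exact ⟨⟨e, he, rfl⟩, fun g hg => by rw [← hp, h g hg]⟩
  rw [this, Set.ncard_image_of_injective _ hinj]

variable (𝔛) in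
/-- An equivariant map which restricts to a covering of degree `d` from the invariant set `T`
onto the set `S`. -/
structure IsCover (p : E → B) (T : Set E) (S : Set B) (d : ℕ) : Prop where
  map_smul : ∀ (g : 𝔛 ≃ₜ 𝔛) e, p (g • e) = g • p e
  smul_mem : ∀ (g : 𝔛 ≃ₜ 𝔛), ∀ e ∈ T, g • e ∈ T
  isOpen : ∀ e ∈ T, IsOpen (MulAction.stabilizer (𝔛 ≃ₜ 𝔛) e : Set (𝔛 ≃ₜ 𝔛))
  mapsTo : ∀ e ∈ T, p e ∈ S
  ne_zero : d ≠ 0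
  ncard_fiber : ∀ b ∈ S, {e | e ∈ T ∧ p e = b}.ncard = d

namespace IsCover

variable {p : E → B} {T : Set E} {S : Set B} {d : ℕ}

omit [IsCantorSpace 𝔛] in
theorem finite_fiber (h : IsCover 𝔛 p T S d) {b : B} (hb : b ∈ S) : {e | e ∈ T ∧ p e = b}.Finite :=
  Set.finite_of_ncard_ne_zero (by rw [h.ncard_fiber b hb]; exact h.ne_zero)

omit [IsCantorSpace 𝔛] in
theorem nonempty_fiber (h : IsCover 𝔛 p T S d) {b : B} (hb : b ∈ S) :
    {e | e ∈ T ∧ p e = b}.Nonempty :=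
  Set.nonempty_of_ncard_ne_zero (by rw [h.ncard_fiber b hb]; exact h.ne_zero)

/-- A stabilizer fixing p e preserves the finite fibre through e, so e has a finite orbit and is
fixed by `fixed_of_finite_orbit`. -/
theorem mem_fixedIn_iff (h : IsCover 𝔛 p T S d) {k : ℕ} {e : E} (he : e ∈ T) :
    e ∈ fixedIn 𝔛 T k ↔ p e ∈ fixedIn 𝔛 S k := by
  refine ⟨fun hf => ⟨h.mapsTo e he, fun g hg => by rw [← h.map_smul, hf.2 g hg]⟩, fun hf => ?_⟩
  refine ⟨he, fixed_of_finite_orbit _ e (h.isOpen e he) ((h.finite_fiber hf.1).subset ?_)⟩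
  rintro _ ⟨g, hg, rfl⟩
  exact ⟨h.smul_mem g e he, by rw [h.map_smul, hf.2 g hg]⟩

theorem finite_fixedIn (h : IsCover 𝔛 p T S d) {k : ℕ} (hT : (fixedIn 𝔛 T k).Finite) :
    (fixedIn 𝔛 S k).Finite := by
  refine (hT.image p).subset fun b hb => ?_
  obtain ⟨e, he, rfl⟩ := h.nonempty_fiber hb.1
  exact ⟨e, (h.mem_fixedIn_iff he).2 hb, rfl⟩

theorem ncard_fixedIn (h : IsCover 𝔛 p T S d) (k : ℕ) :
    (fixedIn 𝔛 T k).ncard = d * (fixedIn 𝔛 S k).ncard := by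
  have e1 : fixedIn 𝔛 T k ≃ Σ b : fixedIn 𝔛 S k, {e | e ∈ T ∧ p e = b} :=
    { toFun := fun e => ⟨⟨p e, (h.mem_fixedIn_iff e.2.1).1 e.2⟩, e, e.2.1, rfl⟩
      invFun := fun x => ⟨x.2, (h.mem_fixedIn_iff x.2.2.1).2 (by rw [x.2.2.2]; exact x.1.2)⟩
      left_inv := fun e => rfl
      right_inv := by
        rintro ⟨⟨b, hb⟩, e, he, rfl : p e = b⟩
        rfl }
  have e2 : ∀ b : fixedIn 𝔛 S k, {e | e ∈ T ∧ p e = b} ≃ Fin d := fun b =>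
    haveI := (h.finite_fiber b.2.1).to_subtype
    Finite.equivFinOfCardEq (h.ncard_fiber b b.2.1)
  have e3 := e1.trans ((Equiv.sigmaCongrRight e2).trans (Equiv.sigmaEquivProd _ _))
  rw [← Nat.card_coe_set_eq, Nat.card_congr e3, Nat.card_prod, Nat.card_fin, mul_comm,
    Nat.card_coe_set_eq]

theorem wt_eq (h : IsCover 𝔛 p T S d) (c : ℚ) : wt 𝔛 c T = d * wt 𝔛 c S := by
  unfold wt
  rw [← smul_eq_mul, ← LinearMap.map_smul]
  congr 1
  funext k
  simp [h.ncard_fixedIn k]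

end IsCover

omit [IsCantorSpace 𝔛] in
theorem isOpen_stabilizer_prod {x : E} {y : B}
    (hx : IsOpen (MulAction.stabilizer (𝔛 ≃ₜ 𝔛) x : Set (𝔛 ≃ₜ 𝔛)))
    (hy : IsOpen (MulAction.stabilizer (𝔛 ≃ₜ 𝔛) y : Set (𝔛 ≃ₜ 𝔛))) :
    IsOpen (MulAction.stabilizer (𝔛 ≃ₜ 𝔛) (x, y) : Set (𝔛 ≃ₜ 𝔛)) := by
  convert hx.inter hy using 1
  ext g
  simp [Prod.ext_iff]

/-- Every orbit with open stabilizers is covered by some `X(n)`. -/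
theorem exists_cover (x : E)
    (hx : IsOpen (MulAction.stabilizer (𝔛 ≃ₜ 𝔛) x : Set (𝔛 ≃ₜ 𝔛))) :
    ∃ (n : ℕ) (p : XSet 𝔛 (n + 1) → E) (d : ℕ),
      IsCover 𝔛 p Set.univ (MulAction.orbit (𝔛 ≃ₜ 𝔛) x) d := by
  obtain ⟨n, ψ, hψ, hσ⟩ := exists_stabilizer_le_finite hx
  obtain _ | n := n
  · exact (ψ.1 (Classical.arbitrary 𝔛)).elim0
  have htr := XSet.transitive 𝔛 (n + 1)
  -- The covering map is χ ↦ γ χ • x; it does not depend on γ because the stabilizer of ψ fixes x.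
  choose γ hγ using fun χ : XSet 𝔛 (n + 1) => MulAction.exists_smul_eq (𝔛 ≃ₜ 𝔛) ψ χ
  have key : ∀ g : 𝔛 ≃ₜ 𝔛, γ (g • ψ) • x = g • x := by
    intro g
    have h1 : g⁻¹ * γ (g • ψ) ∈ MulAction.stabilizer (𝔛 ≃ₜ 𝔛) ψ := by
      rw [MulAction.mem_stabilizer_iff, mul_smul, hγ, inv_smul_smul]
    have h2 : (g⁻¹ * γ (g • ψ)) • x = x := hψ h1
    rwa [mul_smul, inv_smul_eq_iff] at h2
  have hsmul : ∀ (g : 𝔛 ≃ₜ 𝔛) χ, γ (g • χ) • x = g • γ χ • x := by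
    intro g χ
    obtain ⟨h, rfl⟩ := MulAction.exists_smul_eq (𝔛 ≃ₜ 𝔛) ψ χ
    rw [← mul_smul, key, key, mul_smul]
  -- A point χ over x is a translate of ψ by the stabilizer of x, hence σ ∘ ψ for one of finitely
  -- many σ.
  have hfin : {χ : XSet 𝔛 (n + 1) | χ ∈ Set.univ ∧ γ χ • x = x}.Finite := by
    refine Set.Finite.subset (Set.finite_range fun σ : {σ : Fin (n + 1) → Fin (n + 1) //
      ∃ u ∈ MulAction.stabilizer (𝔛 ≃ₜ 𝔛) x, ∀ z, ψ.1 (u.symm z) = σ (ψ.1 z)} =>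
      σ.2.choose • ψ) ?_
    rintro χ ⟨-, hχ⟩
    obtain ⟨σ, hσ'⟩ := hσ (γ χ) hχ
    refine ⟨⟨σ, γ χ, hχ, hσ'⟩, ?_⟩
    generalize_proofs hex
    conv_rhs => rw [← hγ χ]
    exact XSet.ext fun z => ((hex _).choose_spec.2 z).trans (hσ' z).symm
  refine ⟨n, fun χ => γ χ • x, {χ : XSet 𝔛 (n + 1) | χ ∈ Set.univ ∧ γ χ • x = x}.ncard,
    hsmul, fun _ _ _ => trivial, fun χ _ => XSet.smooth 𝔛 _ χ, fun χ _ => ⟨γ χ, rfl⟩, ?_, ?_⟩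
  · refine Set.ncard_ne_zero_of_mem (a := ψ) ⟨trivial, ?_⟩ hfin
    simpa using key 1
  · rintro _ ⟨g, rfl⟩
    rw [← Set.ncard_image_of_injective {χ : XSet 𝔛 (n + 1) | χ ∈ Set.univ ∧ γ χ • x = x}
      (MulAction.injective g)]
    congr 1
    ext χ
    constructor
    · rintro ⟨-, h⟩
      exact ⟨g⁻¹ • χ, ⟨trivial, by rw [hsmul, h]; exact inv_smul_smul g x⟩, smul_inv_smul g χ⟩
    · rintro ⟨χ, ⟨-, h⟩, rfl⟩
      exact ⟨trivial, by rw [hsmul, h]⟩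

/-- An equivariant embedding of a `G`-set into the locally constant maps from `𝔛` to `F`. -/
structure IsEvaluation {F : Type*} (ev : E → 𝔛 → F) : Prop where
  injective : Function.Injective ev
  isLocallyConstant : ∀ e, IsLocallyConstant (ev e)
  smul_apply : ∀ (g : 𝔛 ≃ₜ 𝔛) e x, ev (g • e) x = ev e (g.symm x)

/-- The ranges of the maps given by the elements of `S`. -/
noncomputable def rangeTypes {F : Type*} [Fintype F] (ev : E → 𝔛 → F) (S : Set E) :
    Finset (Finset F) :=
  open Classical in Finset.univ.filter fun R => ∃ e ∈ S, Set.range (ev e) = R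

omit [TopologicalSpace 𝔛] [IsCantorSpace 𝔛] [MulAction (𝔛 ≃ₜ 𝔛) E] in
theorem mem_rangeTypes {F : Type*} [Fintype F] {ev : E → 𝔛 → F} {S : Set E} {R : Finset F} :
    R ∈ rangeTypes ev S ↔ ∃ e ∈ S, Set.range (ev e) = R := by
  simp [rangeTypes]

theorem card_range_eq {F : Type*} [Fintype F] [DecidableEq F] {R : Finset F} (hR : R.Nonempty)
    (k : ℕ) : (Finset.univ.filter fun Θ : Fin (k + 1) → F => Finset.univ.image Θ = R).card
      = surjCount (R.card - 1) k := by
  have hc : R.card = R.card - 1 + 1 := (Nat.succ_pred_eq_of_pos hR.card_pos).symm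
  let e : R ≃ Fin (R.card - 1 + 1) := R.equivFin.trans (finCongr hc)
  unfold surjCount
  rw [← Fintype.card_coe, ← Nat.card_eq_fintype_card]
  refine (Nat.card_congr ?_).symm
  refine
    { toFun := fun f => ⟨fun i => e.symm (f.1 i), ?_⟩
      invFun := fun Θ => ⟨fun i => e ⟨Θ.1 i, ?_⟩, ?_⟩
      left_inv := ?_
      right_inv := ?_ }
  · refine Finset.mem_filter.2 ⟨Finset.mem_univ _, ?_⟩
    ext y
    simp only [Finset.mem_image, Finset.mem_univ, true_and]
    constructor
    · rintro ⟨i, rfl⟩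
      exact (e.symm (f.1 i)).2
    · intro hy
      obtain ⟨i, hi⟩ := f.2 (e ⟨y, hy⟩)
      exact ⟨i, by simp [hi]⟩
  · have := Finset.mem_image_of_mem Θ.1 (Finset.mem_univ i)
    rwa [(Finset.mem_filter.1 Θ.2).2] at this
  · intro j
    have : ((e.symm j : R) : F) ∈ Finset.univ.image Θ.1 :=
      (Finset.mem_filter.1 Θ.2).2.symm ▸ (e.symm j).2
    obtain ⟨i, -, hi⟩ := Finset.mem_image.1 this
    exact ⟨i, by simp [hi]⟩
  · intro f
    simp
  · intro Θ
    simp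

namespace IsEvaluation

variable {F : Type*} [Fintype F] {ev : E → 𝔛 → F}

/-- A map fixed by the stabilizer of the base point factors through it as some Θ. Conversely, S is
invariant and the range determines the orbit, so whether Θ occurs depends only on its image. -/
theorem image_fixedIn [DecidableEq F] (hev : IsEvaluation ev) {S : Set E}
    (hS : ∀ (g : 𝔛 ≃ₜ 𝔛), ∀ e ∈ S, g • e ∈ S) (k : ℕ) :
    ev '' fixedIn 𝔛 S k = (fun Θ : Fin (k + 1) → F => fun x => Θ ((basePoint 𝔛 k).1 x)) ''
      (Finset.univ.filter fun Θ => Finset.univ.image Θ ∈ rangeTypes ev S :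
        Finset (Fin (k + 1) → F)) := by
  have hrange : ∀ Θ : Fin (k + 1) → F, Set.range (fun x => Θ ((basePoint 𝔛 k).1 x))
      = (Finset.univ.image Θ : Finset F) := by
    intro Θ
    rw [Finset.coe_image, Finset.coe_univ, Set.image_univ]
    exact (basePoint 𝔛 k).2.range_comp Θ
  ext α
  constructor
  · rintro ⟨e, ⟨he, hfix⟩, rfl⟩
    obtain ⟨Θ, hΘ⟩ := exists_eq_comp_of_fixed (basePoint 𝔛 k) (hev.isLocallyConstant e)
      fun g hg x => by rw [← hev.smul_apply, hfix g hg]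
    refine ⟨Θ, ?_, funext fun x => (hΘ x).symm⟩
    simp only [Finset.coe_filter, Finset.mem_univ, true_and, Set.mem_ofPred_eq, mem_rangeTypes]
    refine ⟨e, he, ?_⟩
    rw [← hrange, funext hΘ]
  · rintro ⟨Θ, hΘ, rfl⟩
    simp only [Finset.coe_filter, Finset.mem_univ, true_and, Set.mem_ofPred_eq,
      mem_rangeTypes] at hΘ
    obtain ⟨e, he, hr⟩ := hΘ
    obtain ⟨g, hg⟩ := exists_homeo_of_range_eq (hev.isLocallyConstant e)
      ((basePoint 𝔛 k).isLocallyConstant.comp Θ) (hr.trans (hrange Θ).symm)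
    have hge : ev (g • e) = fun x => Θ ((basePoint 𝔛 k).1 x) :=
      funext fun x => (hev.smul_apply g e x).trans (hg x)
    refine ⟨g • e, ⟨hS g e he, fun h hh => hev.injective (funext fun x => ?_)⟩, hge⟩
    rw [hev.smul_apply, hge]
    exact congrArg (fun θ : XSet 𝔛 (k + 1) => Θ (θ.1 x)) hh

theorem finite_fixedIn (hev : IsEvaluation ev) {S : Set E}
    (hS : ∀ (g : 𝔛 ≃ₜ 𝔛), ∀ e ∈ S, g • e ∈ S) (k : ℕ) : (fixedIn 𝔛 S k).Finite := by
  classical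
  refine Set.Finite.of_finite_image ?_ hev.injective.injOn
  rw [hev.image_fixedIn hS]
  exact (Finset.finite_toSet _).image _

/-- Sorting the maps Θ of `image_fixedIn` by image R gives `surjCount (R.card - 1) k` of each kind,
which the functional sends to the corresponding power of c. -/
theorem wt_eq (hev : IsEvaluation ev) {S : Set E}
    (hS : ∀ (g : 𝔛 ≃ₜ 𝔛), ∀ e ∈ S, g • e ∈ S) (c : ℚ) :
    wt 𝔛 c S = ∑ R ∈ rangeTypes ev S, c ^ (R.card - 1) := by
  classical
  have hne : ∀ R ∈ rangeTypes ev S, R.Nonempty := by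
    intro R hR
    obtain ⟨e, -, he⟩ := mem_rangeTypes.1 hR
    rw [← Finset.coe_nonempty, ← he]
    exact Set.range_nonempty _
  have hcount : ∀ k, (fixedIn 𝔛 S k).ncard
      = ∑ R ∈ rangeTypes ev S, surjCount (R.card - 1) k := by
    intro k
    rw [← Set.ncard_image_of_injective _ hev.injective, hev.image_fixedIn hS,
      Set.ncard_image_of_injective, Set.ncard_coe_finset,
      Finset.card_eq_sum_card_fiberwise (f := fun Θ => Finset.univ.image Θ)
        (t := rangeTypes ev S)]
    · refine Finset.sum_congr rfl fun R hR => ?_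
      rw [← card_range_eq (hne R hR)]
      congr 1
      ext Θ
      simp only [Finset.mem_filter, Finset.mem_univ, true_and, and_iff_right_iff_imp]
      rintro rfl
      exact hR
    · intro Θ hΘ
      simpa using hΘ
    · intro Θ Θ' h
      funext i
      obtain ⟨x, rfl⟩ := (basePoint 𝔛 k).2 i
      exact congrFun h x
  unfold wt
  simp_rw [← surjFunctional_surjCount c, ← map_sum]
  congr 1
  funext k
  rw [hcount, Finset.sum_apply, Nat.cast_sum]

end IsEvaluation

omit [IsCantorSpace 𝔛] in
theorem XSet.isEvaluation (n : ℕ) : IsEvaluation (fun (φ : XSet 𝔛 n) x => φ.1 x) where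
  injective _ _ h := XSet.ext (congrFun h)
  isLocallyConstant φ := φ.isLocallyConstant
  smul_apply _ _ _ := rfl

omit [IsCantorSpace 𝔛] in
theorem IsEvaluation.prod {F F' : Type*} {ev : E → 𝔛 → F} {ev' : B → 𝔛 → F'}
    (h : IsEvaluation ev) (h' : IsEvaluation ev') :
    IsEvaluation (fun (z : E × B) x => (ev z.1 x, ev' z.2 x)) where
  injective z w hzw := by
    have h1 := fun x => Prod.ext_iff.1 (congrFun hzw x)
    exact Prod.ext (h.injective (funext fun x => (h1 x).1)) (h'.injective (funext fun x => (h1 x).2))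
  isLocallyConstant z := (h.isLocallyConstant z.1).prodMk (h'.isLocallyConstant z.2)
  smul_apply g z x := Prod.ext (h.smul_apply g z.1 x) (h'.smul_apply g z.2 x)

theorem wt_XSet (c : ℚ) (n : ℕ) : wt 𝔛 c (Set.univ : Set (XSet 𝔛 (n + 1))) = c ^ n := by
  rw [(XSet.isEvaluation (n + 1)).wt_eq (fun _ _ _ => Set.mem_univ _)]
  have : rangeTypes (fun (φ : XSet 𝔛 (n + 1)) x => φ.1 x) Set.univ = {Finset.univ} := by
    ext R
    rw [mem_rangeTypes, Finset.mem_singleton]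
    constructor
    · rintro ⟨φ, -, h⟩
      rw [← Finset.coe_eq_univ, ← h]
      exact φ.2.range_eq
    · rintro rfl
      exact ⟨basePoint 𝔛 n, trivial, by rw [Finset.coe_univ]; exact (basePoint 𝔛 n).2.range_eq⟩
  rw [this, Finset.sum_singleton]
  simp

/-- A covering of degree d by X(n+1) gives c^n = d · wt. -/
theorem wt_orbit_ne_zero {c : ℚ} (hc : c ≠ 0) (x : E)
    (hx : IsOpen (MulAction.stabilizer (𝔛 ≃ₜ 𝔛) x : Set (𝔛 ≃ₜ 𝔛))) :
    wt 𝔛 c (MulAction.orbit (𝔛 ≃ₜ 𝔛) x) ≠ 0 := by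
  obtain ⟨n, p, d, hp⟩ := exists_cover x hx
  intro h0
  have := hp.wt_eq c
  rw [wt_XSet, h0, mul_zero] at this
  exact pow_ne_zero n hc this

theorem finite_fixedIn_orbit (x : E)
    (hx : IsOpen (MulAction.stabilizer (𝔛 ≃ₜ 𝔛) x : Set (𝔛 ≃ₜ 𝔛))) (k : ℕ) :
    (fixedIn 𝔛 (MulAction.orbit (𝔛 ≃ₜ 𝔛) x) k).Finite := by
  obtain ⟨n, p, d, hp⟩ := exists_cover x hx
  exact hp.finite_fixedIn ((XSet.isEvaluation (n + 1)).finite_fixedIn (fun _ _ _ => Set.mem_univ _) k)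

theorem finite_fixedIn_univ
    (hE : ∀ x : E, IsOpen (MulAction.stabilizer (𝔛 ≃ₜ 𝔛) x : Set (𝔛 ≃ₜ 𝔛)))
    [Finite (MulAction.orbitRel.Quotient (𝔛 ≃ₜ 𝔛) E)] (S : Set E) (k : ℕ) :
    (fixedIn 𝔛 S k).Finite := by
  refine Set.Finite.subset (Set.finite_iUnion fun o : MulAction.orbitRel.Quotient (𝔛 ≃ₜ 𝔛) E =>
    finite_fixedIn_orbit o.out (hE _) k) fun e he => ?_
  refine Set.mem_iUnion.2 ⟨Quotient.mk'' e, ?_, he.2⟩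
  let _ := MulAction.orbitRel (𝔛 ≃ₜ 𝔛) E
  exact MulAction.orbitRel_apply.1 (Setoid.symm (Quotient.mk_out e))

end Weights

/-! ### Base change for weights. -/

section BaseChange

variable {𝔛 : Type u} [TopologicalSpace 𝔛] [IsCantorSpace 𝔛]

omit [IsCantorSpace 𝔛] in
/-- The base change of a covering. -/
theorem IsCover.pullback {E B C : Type*} [MulAction (𝔛 ≃ₜ 𝔛) E] [MulAction (𝔛 ≃ₜ 𝔛) B]
    [MulAction (𝔛 ≃ₜ 𝔛) C] {r : C → B} {d : ℕ} (hr : IsCover 𝔛 r Set.univ Set.univ d)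
    {h : E → B} (hh : ∀ (g : 𝔛 ≃ₜ 𝔛) e, h (g • e) = g • h e) {S : Set E}
    (hS : ∀ (g : 𝔛 ≃ₜ 𝔛), ∀ e ∈ S, g • e ∈ S)
    (hopen : ∀ e ∈ S, IsOpen (MulAction.stabilizer (𝔛 ≃ₜ 𝔛) e : Set (𝔛 ≃ₜ 𝔛))) :
    IsCover 𝔛 (Prod.fst : E × C → E) {z | z.1 ∈ S ∧ h z.1 = r z.2} S d where
  map_smul _ _ := rfl
  smul_mem g z hz := ⟨hS g _ hz.1, by
    change h (g • z.1) = r (g • z.2)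
    rw [hh, hr.map_smul, hz.2]⟩
  isOpen z hz := isOpen_stabilizer_prod (hopen _ hz.1) (hr.isOpen _ trivial)
  mapsTo z hz := hz.1
  ne_zero := hr.ne_zero
  ncard_fiber e he := by
    rw [← hr.ncard_fiber (h e) trivial, ← Set.ncard_image_of_injective
      {c | c ∈ Set.univ ∧ r c = h e} (Prod.mk_right_injective e)]
    congr 1
    ext ⟨e', c⟩
    constructor
    · rintro ⟨⟨-, h1⟩, rfl : e' = e⟩
      exact ⟨c, ⟨trivial, h1.symm⟩, rfl⟩
    · rintro ⟨c, ⟨-, h1⟩, h2⟩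
      obtain ⟨rfl, rfl⟩ := Prod.mk.injEq .. ▸ h2
      exact ⟨⟨he, h1.symm⟩, rfl⟩

omit [IsCantorSpace 𝔛] in
/-- The product of two coverings, restricted to a fibre product. -/
theorem IsCover.prod {E E' B B' C : Type*} [MulAction (𝔛 ≃ₜ 𝔛) E] [MulAction (𝔛 ≃ₜ 𝔛) E']
    [MulAction (𝔛 ≃ₜ 𝔛) B] [MulAction (𝔛 ≃ₜ 𝔛) B'] [MulAction (𝔛 ≃ₜ 𝔛) C] {p : E → B} {q : E' → B'}
    {S : Set B} {S' : Set B'} {d d' : ℕ} (hp : IsCover 𝔛 p Set.univ S d)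
    (hq : IsCover 𝔛 q Set.univ S' d') {f : B → C} {f' : B' → C}
    (hf : ∀ (g : 𝔛 ≃ₜ 𝔛) b, f (g • b) = g • f b) (hf' : ∀ (g : 𝔛 ≃ₜ 𝔛) b, f' (g • b) = g • f' b) :
    IsCover 𝔛 (Prod.map p q) {z | f (p z.1) = f' (q z.2)}
      {z | z.1 ∈ S ∧ z.2 ∈ S' ∧ f z.1 = f' z.2} (d * d') where
  map_smul g z := Prod.ext (hp.map_smul g z.1) (hq.map_smul g z.2)
  smul_mem g z hz := by
    change f (p (g • z.1)) = f' (q (g • z.2))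
    rw [hp.map_smul, hq.map_smul, hf, hf']
    exact congrArg _ hz
  isOpen z _ := isOpen_stabilizer_prod (hp.isOpen _ trivial) (hq.isOpen _ trivial)
  mapsTo z hz := ⟨hp.mapsTo _ trivial, hq.mapsTo _ trivial, hz⟩
  ne_zero := mul_ne_zero hp.ne_zero hq.ne_zero
  ncard_fiber := by
    rintro ⟨b, b'⟩ ⟨hb, hb', hbb : f b = f' b'⟩
    rw [← hp.ncard_fiber b hb, ← hq.ncard_fiber b' hb', ← Set.ncard_prod]
    congr 1
    ext ⟨e, e'⟩
    constructor
    · rintro ⟨-, h⟩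
      obtain ⟨rfl, rfl⟩ := Prod.mk.injEq .. ▸ h
      exact ⟨⟨trivial, rfl⟩, trivial, rfl⟩
    · rintro ⟨⟨-, rfl : p e = b⟩, -, rfl : q e' = b'⟩
      exact ⟨hbb, rfl⟩

omit [TopologicalSpace 𝔛] [IsCantorSpace 𝔛] in
theorem mul_sum_rangeTypes [Nonempty 𝔛] {F E : Type*} [Fintype F] (c : ℚ) (ev : E → 𝔛 → F)
    (T : Set E) :
    c * ∑ R ∈ rangeTypes ev T, c ^ (R.card - 1) = ∑ R ∈ rangeTypes ev T, c ^ R.card := by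
  rw [Finset.mul_sum]
  refine Finset.sum_congr rfl fun R hR => ?_
  obtain ⟨e, -, he⟩ := mem_rangeTypes.1 hR
  have hne : R.Nonempty := by
    rw [← Finset.coe_nonempty, ← he]
    exact Set.range_nonempty _
  rw [← pow_succ', Nat.sub_add_cancel hne.card_pos]

/-- The case of `X(a) → Y` and `X(b) → Y` after base change to a covering `X(n) → Y`. -/
theorem wt_triple {c : ℚ} (hc : (c + 1) * (c + 2) = 0) {Y : Type*} [MulAction (𝔛 ≃ₜ 𝔛) Y]
    {a b n : ℕ} {f : XSet 𝔛 a → Y} {f' : XSet 𝔛 b → Y} {r : XSet 𝔛 (n + 1) → Y}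
    (hf : ∀ (g : 𝔛 ≃ₜ 𝔛) e, f (g • e) = g • f e) (hf' : ∀ (g : 𝔛 ≃ₜ 𝔛) e, f' (g • e) = g • f' e)
    (hr : ∀ (g : 𝔛 ≃ₜ 𝔛) e, r (g • e) = g • r e) :
    wt 𝔛 c {z : (XSet 𝔛 a × XSet 𝔛 b) × XSet 𝔛 (n + 1) | f z.1.1 = f' z.1.2 ∧ f z.1.1 = r z.2}
      * wt 𝔛 c (Set.univ : Set (XSet 𝔛 (n + 1)))
      = wt 𝔛 c {z : XSet 𝔛 a × XSet 𝔛 (n + 1) | f z.1 = r z.2}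
        * wt 𝔛 c {z : XSet 𝔛 b × XSet 𝔛 (n + 1) | f' z.1 = r z.2} := by
  classical
  have hc0 : c ≠ 0 := by
    rintro rfl
    norm_num at hc
  set S := {z : (XSet 𝔛 a × XSet 𝔛 b) × XSet 𝔛 (n + 1) | f z.1.1 = f' z.1.2 ∧ f z.1.1 = r z.2}
    with hS
  set P := {z : XSet 𝔛 a × XSet 𝔛 (n + 1) | f z.1 = r z.2} with hP
  set Q := {z : XSet 𝔛 b × XSet 𝔛 (n + 1) | f' z.1 = r z.2} with hQ
  have hPi : ∀ (g : 𝔛 ≃ₜ 𝔛), ∀ e ∈ P, g • e ∈ P := fun g e (he : f e.1 = r e.2) => by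
    change f (g • e.1) = r (g • e.2)
    rw [hf, hr, he]
  have hQi : ∀ (g : 𝔛 ≃ₜ 𝔛), ∀ e ∈ Q, g • e ∈ Q := fun g e (he : f' e.1 = r e.2) => by
    change f' (g • e.1) = r (g • e.2)
    rw [hf', hr, he]
  have hSi : ∀ (g : 𝔛 ≃ₜ 𝔛), ∀ e ∈ S, g • e ∈ S := fun g e he => by
    change f (g • e.1.1) = f' (g • e.1.2) ∧ f (g • e.1.1) = r (g • e.2)
    rw [hf, hr, hf', ← he.1, ← he.2]
    exact ⟨rfl, rfl⟩
  let evP : XSet 𝔛 a × XSet 𝔛 (n + 1) → 𝔛 → Fin a × Fin (n + 1) := fun z x => (z.1.1 x, z.2.1 x)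
  let evQ : XSet 𝔛 b × XSet 𝔛 (n + 1) → 𝔛 → Fin b × Fin (n + 1) := fun z x => (z.1.1 x, z.2.1 x)
  let evS : (XSet 𝔛 a × XSet 𝔛 b) × XSet 𝔛 (n + 1) → 𝔛 → Fin a × Fin b × Fin (n + 1) :=
    fun z x => (z.1.1.1 x, z.1.2.1 x, z.2.1 x)
  have hevP : IsEvaluation evP := (XSet.isEvaluation a).prod (XSet.isEvaluation (n + 1))
  have hevQ : IsEvaluation evQ := (XSet.isEvaluation b).prod (XSet.isEvaluation (n + 1))
  have hevS : IsEvaluation evS :=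
    { injective := fun z w hzw => by
        have h1 := fun x => congrFun hzw x
        simp only [evS, Prod.mk.injEq] at h1
        exact Prod.ext (Prod.ext (XSet.ext fun x => (h1 x).1) (XSet.ext fun x => (h1 x).2.1))
          (XSet.ext fun x => (h1 x).2.2)
      isLocallyConstant := fun z => z.1.1.isLocallyConstant.prodMk
        (z.1.2.isLocallyConstant.prodMk z.2.isLocallyConstant)
      smul_apply := fun _ _ _ => rfl }
  have himP : ∀ z : (XSet 𝔛 a × XSet 𝔛 b) × XSet 𝔛 (n + 1),
      ∀ R : Finset (Fin a × Fin b × Fin (n + 1)),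
      Set.range (evS z) = R → Set.range (evP (z.1.1, z.2)) = R.image fun x => (x.1, x.2.2) := by
    intro z R h
    rw [Finset.coe_image, ← h, ← Set.range_comp]
    rfl
  have himQ : ∀ z : (XSet 𝔛 a × XSet 𝔛 b) × XSet 𝔛 (n + 1),
      ∀ R : Finset (Fin a × Fin b × Fin (n + 1)),
      Set.range (evS z) = R → Set.range (evQ (z.1.2, z.2)) = R.image fun x => x.2 := by
    intro z R h
    rw [Finset.coe_image, ← h, ← Set.range_comp]
    rfl
  -- Every amalgamation R is realized: take θ with range R and move z and w onto its two
  -- projections. The moved pairs then share their last coordinate and glue to a point of S.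
  have hlift : ∀ A ∈ rangeTypes evP P, ∀ B ∈ rangeTypes evQ Q,
      ∀ R : Finset (Fin a × Fin b × Fin (n + 1)), R.image (fun x => (x.1, x.2.2)) = A →
      R.image (fun x => x.2) = B → R ∈ rangeTypes evS S := by
    intro A hA B hB R hRA hRB
    obtain ⟨z, hz, hzA⟩ := mem_rangeTypes.1 hA
    obtain ⟨w, hw, hwB⟩ := mem_rangeTypes.1 hB
    have hR : R.Nonempty := by
      rw [← Finset.image_nonempty (f := fun x => (x.1, x.2.2)), hRA, ← Finset.coe_nonempty, ← hzA]
      exact Set.range_nonempty _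
    have := hR.to_subtype
    obtain ⟨θ, hθ, hθs⟩ := exists_isLocallyConstant_surjective 𝔛 R
    have hθR : Set.range (fun x => (θ x).1) = R := by
      exact (hθs.range_comp Subtype.val).trans Subtype.range_coe
    have hθA : Set.range (evP z) = Set.range fun x => ((θ x).1.1, (θ x).1.2.2) := by
      rw [hzA, ← hRA, Finset.coe_image, ← hθR, ← Set.range_comp]
      rfl
    have hθB : Set.range (evQ w) = Set.range fun x => (θ x).1.2 := by
      rw [hwB, ← hRB, Finset.coe_image, ← hθR, ← Set.range_comp]
      rfl
    obtain ⟨g, hg⟩ := exists_homeo_of_range_eq (hevP.isLocallyConstant z)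
      (hθ.comp fun y => (y.1.1, y.1.2.2)) hθA
    obtain ⟨h, hh⟩ := exists_homeo_of_range_eq (hevQ.isLocallyConstant w)
      (hθ.comp fun y => y.1.2) hθB
    have hgz := hPi g z hz
    have hhw := hQi h w hw
    simp only [evP, evQ, Function.comp, Prod.ext_iff] at hg hh
    have h2 : (g • z).2 = (h • w).2 := XSet.ext fun x => (hg x).2.trans (hh x).2.symm
    refine mem_rangeTypes.2 ⟨(((g • z).1, (h • w).1), (g • z).2), ⟨?_, hgz⟩, ?_⟩
    · have h3 : f' (h • w).1 = r (h • w).2 := hhw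
      rw [← h2] at h3
      exact Eq.trans hgz h3.symm
    · rw [← hθR]
      congr 1
      funext x
      exact Prod.ext (hg x).1 (Prod.ext (hh x).1 (hg x).2)
  have hmaps : ∀ R ∈ rangeTypes evS S,
      (R.image (fun x => (x.1, x.2.2)), R.image (fun x => x.2))
        ∈ rangeTypes evP P ×ˢ rangeTypes evQ Q := by
    intro R hR
    obtain ⟨z, hz, hzR⟩ := mem_rangeTypes.1 hR
    exact Finset.mem_product.2 ⟨mem_rangeTypes.2 ⟨_, hz.2, himP z R hzR⟩,
      mem_rangeTypes.2 ⟨_, hz.1.symm.trans hz.2, himQ z R hzR⟩⟩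
  have key : c ^ (n + 1) * ∑ R ∈ rangeTypes evS S, c ^ R.card
      = (∑ A ∈ rangeTypes evP P, c ^ A.card) * ∑ B ∈ rangeTypes evQ Q, c ^ B.card := by
    rw [← Finset.sum_fiberwise_of_maps_to hmaps, Finset.sum_product, Finset.sum_mul_sum,
      Finset.mul_sum]
    refine Finset.sum_congr rfl fun A hA => ?_
    rw [Finset.mul_sum]
    refine Finset.sum_congr rfl fun B hB => ?_
    obtain ⟨z, -, hzA⟩ := mem_rangeTypes.1 hA
    obtain ⟨w, -, hwB⟩ := mem_rangeTypes.1 hB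
    have h1 := sum_amalgamations hc A B
      (fun k => by
        obtain ⟨x, hx⟩ := z.2.2 k
        refine ⟨z.1.1 x, ?_⟩
        rw [← Finset.mem_coe, ← hzA]
        exact ⟨x, Prod.ext rfl hx⟩)
      (fun k => by
        obtain ⟨x, hx⟩ := w.2.2 k
        refine ⟨w.1.1 x, ?_⟩
        rw [← Finset.mem_coe, ← hwB]
        exact ⟨x, Prod.ext rfl hx⟩)
    rw [Fintype.card_fin] at h1
    rw [← h1]
    congr 1
    refine Finset.sum_congr ?_ fun _ _ => rfl
    ext R
    simp only [Finset.mem_filter, Finset.mem_univ, true_and, Prod.mk.injEq,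
      and_iff_right_iff_imp]
    exact fun h => hlift A hA B hB R h.1 h.2
  rw [hevS.wt_eq hSi, hevP.wt_eq hPi, hevQ.wt_eq hQi, wt_XSet]
  -- Weights use the exponent #R - 1 and amalgamations #R, which costs a factor c² on each side.
  refine mul_left_cancel₀ (pow_ne_zero 2 hc0) ?_
  rw [← mul_sum_rangeTypes c evS, ← mul_sum_rangeTypes c evP, ← mul_sum_rangeTypes c evQ] at key
  linear_combination key

/-- Base change for orbits. -/
theorem wt_fiberProduct_orbit {c : ℚ} (hc : (c + 1) * (c + 2) = 0) {X Y Y' : Type*}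
    [MulAction (𝔛 ≃ₜ 𝔛) X] [MulAction (𝔛 ≃ₜ 𝔛) Y] [MulAction (𝔛 ≃ₜ 𝔛) Y']
    [MulAction.IsPretransitive (𝔛 ≃ₜ 𝔛) Y] {f : X → Y} {f' : Y' → Y}
    (hf : ∀ (g : 𝔛 ≃ₜ 𝔛) e, f (g • e) = g • f e) (hf' : ∀ (g : 𝔛 ≃ₜ 𝔛) e, f' (g • e) = g • f' e)
    {x : X} {y' : Y'} (hx : IsOpen (MulAction.stabilizer (𝔛 ≃ₜ 𝔛) x : Set (𝔛 ≃ₜ 𝔛)))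
    (hy' : IsOpen (MulAction.stabilizer (𝔛 ≃ₜ 𝔛) y' : Set (𝔛 ≃ₜ 𝔛)))
    (hy : IsOpen (MulAction.stabilizer (𝔛 ≃ₜ 𝔛) (f x) : Set (𝔛 ≃ₜ 𝔛))) :
    wt 𝔛 c {z : X × Y' | z.1 ∈ MulAction.orbit (𝔛 ≃ₜ 𝔛) x ∧ z.2 ∈ MulAction.orbit (𝔛 ≃ₜ 𝔛) y' ∧
      f z.1 = f' z.2} * wt 𝔛 c (Set.univ : Set Y)
      = wt 𝔛 c (MulAction.orbit (𝔛 ≃ₜ 𝔛) x) * wt 𝔛 c (MulAction.orbit (𝔛 ≃ₜ 𝔛) y') := by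
  obtain ⟨a, p, d₁, hp⟩ := exists_cover x hx
  obtain ⟨b, q, d₂, hq⟩ := exists_cover y' hy'
  obtain ⟨n, r, d₃, hr⟩ := exists_cover (f x) hy
  rw [MulAction.orbit_eq_univ] at hr
  have hfp : ∀ (g : 𝔛 ≃ₜ 𝔛) e, f (p (g • e)) = g • f (p e) := fun g e => by rw [hp.map_smul, hf]
  have hfq : ∀ (g : 𝔛 ≃ₜ 𝔛) e, f' (q (g • e)) = g • f' (q e) := fun g e => by
    rw [hq.map_smul, hf']
  have e1 := (hp.prod hq hf hf').wt_eq c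
  have e2 := (hr.pullback (h := fun z : XSet 𝔛 (a + 1) × XSet 𝔛 (b + 1) => f (p z.1))
    (fun g z => hfp g z.1) (hp.prod hq hf hf').smul_mem (hp.prod hq hf hf').isOpen).wt_eq c
  have e3 := (hr.pullback (h := fun z => f (p z)) hfp (S := Set.univ) (fun _ _ _ => trivial)
    fun e _ => XSet.smooth 𝔛 _ e).wt_eq c
  have e4 := (hr.pullback (h := fun z => f' (q z)) hfq (S := Set.univ) (fun _ _ _ => trivial)
    fun e _ => XSet.smooth 𝔛 _ e).wt_eq c
  have e5 := hp.wt_eq c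
  have e6 := hq.wt_eq c
  have e7 := hr.wt_eq c
  have key := wt_triple hc (f := fun z => f (p z)) (f' := fun z => f' (q z)) hfp hfq hr.map_smul
  simp only [Set.mem_univ, true_and] at e3 e4
  rw [e3, e4, e5, e6, e7] at key
  erw [e2, e1] at key
  have h1 : (d₁ : ℚ) ≠ 0 := Nat.cast_ne_zero.2 hp.ne_zero
  have h2 : (d₂ : ℚ) ≠ 0 := Nat.cast_ne_zero.2 hq.ne_zero
  have h3 : (d₃ : ℚ) ≠ 0 := Nat.cast_ne_zero.2 hr.ne_zero
  -- Passing to the coverings multiplies both sides by d₁ d₂ d₃².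
  refine mul_left_cancel₀ (mul_ne_zero (mul_ne_zero h1 h2) (mul_ne_zero h3 h3)) ?_
  push_cast at key
  linear_combination key

omit [IsCantorSpace 𝔛] in
theorem mk_eq_iff_mem_orbit_out {E : Type*} [MulAction (𝔛 ≃ₜ 𝔛) E] (e : E)
    (o : MulAction.orbitRel.Quotient (𝔛 ≃ₜ 𝔛) E) :
    (Quotient.mk'' e : MulAction.orbitRel.Quotient (𝔛 ≃ₜ 𝔛) E) = o
      ↔ e ∈ MulAction.orbit (𝔛 ≃ₜ 𝔛) o.out := by
  rw [← MulAction.orbitRel_apply, ← Quotient.eq'', Quotient.out_eq']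

/-- Base change. -/
theorem wt_fiberProduct {c : ℚ} (hc : (c + 1) * (c + 2) = 0) {X Y Y' : Type*}
    [MulAction (𝔛 ≃ₜ 𝔛) X] [MulAction (𝔛 ≃ₜ 𝔛) Y] [MulAction (𝔛 ≃ₜ 𝔛) Y']
    [MulAction.IsPretransitive (𝔛 ≃ₜ 𝔛) Y] {f : X → Y} {f' : Y' → Y}
    (hf : ∀ (g : 𝔛 ≃ₜ 𝔛) e, f (g • e) = g • f e) (hf' : ∀ (g : 𝔛 ≃ₜ 𝔛) e, f' (g • e) = g • f' e)
    (hX : ∀ x : X, IsOpen (MulAction.stabilizer (𝔛 ≃ₜ 𝔛) x : Set (𝔛 ≃ₜ 𝔛)))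
    (hY' : ∀ y : Y', IsOpen (MulAction.stabilizer (𝔛 ≃ₜ 𝔛) y : Set (𝔛 ≃ₜ 𝔛)))
    (hY : ∀ y : Y, IsOpen (MulAction.stabilizer (𝔛 ≃ₜ 𝔛) y : Set (𝔛 ≃ₜ 𝔛)))
    [Finite (MulAction.orbitRel.Quotient (𝔛 ≃ₜ 𝔛) X)]
    [Finite (MulAction.orbitRel.Quotient (𝔛 ≃ₜ 𝔛) Y')] :
    wt 𝔛 c {z : X × Y' | f z.1 = f' z.2} * wt 𝔛 c (Set.univ : Set Y)
      = wt 𝔛 c (Set.univ : Set X) * wt 𝔛 c (Set.univ : Set Y') := by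
  let _ := Fintype.ofFinite (MulAction.orbitRel.Quotient (𝔛 ≃ₜ 𝔛) X)
  let _ := Fintype.ofFinite (MulAction.orbitRel.Quotient (𝔛 ≃ₜ 𝔛) Y')
  let π : X → MulAction.orbitRel.Quotient (𝔛 ≃ₜ 𝔛) X := Quotient.mk''
  let π' : Y' → MulAction.orbitRel.Quotient (𝔛 ≃ₜ 𝔛) Y' := Quotient.mk''
  rw [wt_eq_sum c π _ (finite_fixedIn_univ hX _), wt_eq_sum c π' _ (finite_fixedIn_univ hY' _),
    wt_eq_sum c (Prod.map π π') _ fun k => ?_, Fintype.sum_prod_type, Finset.sum_mul_sum,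
    Finset.sum_mul]
  · refine Finset.sum_congr rfl fun o _ => ?_
    rw [Finset.sum_mul]
    refine Finset.sum_congr rfl fun o' _ => ?_
    convert wt_fiberProduct_orbit hc hf hf' (hX o.out) (hY' o'.out) (hY _) using 3
    · ext z
      simp only [Set.mem_ofPred_eq, Prod.ext_iff, Prod.map_fst, Prod.map_snd,
        ← mk_eq_iff_mem_orbit_out, π, π']
      tauto
    · ext x
      simp [← mk_eq_iff_mem_orbit_out, π]
    · ext x
      simp [← mk_eq_iff_mem_orbit_out, π']
  · refine ((finite_fixedIn_univ hX Set.univ k).prod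
      (finite_fixedIn_univ hY' Set.univ k)).subset fun z hz => ?_
    exact ⟨⟨trivial, fun g hg => congrArg Prod.fst (hz.2 g hg)⟩,
      ⟨trivial, fun g hg => congrArg Prod.snd (hz.2 g hg)⟩⟩

end BaseChange

/-! ### The measure as a ratio of weights. -/

section Existence

variable {𝔛 : Type u} [TopologicalSpace 𝔛] [IsCantorSpace 𝔛]

theorem FinGSet.wt_univ_ne_zero {c : ℚ} (hc : c ≠ 0) {Y : FinGSet (𝔛 ≃ₜ 𝔛)}
    (hY : Y.IsTransitive) : wt 𝔛 c (Set.univ : Set Y) ≠ 0 := by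
  obtain ⟨⟨y⟩, h⟩ := hY
  rw [← MulAction.orbit_eq_univ (𝔛 ≃ₜ 𝔛) y]
  exact wt_orbit_ne_zero hc y (Y.smooth y)

theorem ne_zero_of_mul_eq_zero {c : ℚ} (hc : (c + 1) * (c + 2) = 0) : c ≠ 0 := by
  rintro rfl
  norm_num at hc

theorem wt_univ_eq_of_bijective (c : ℚ) {E B : Type*} [MulAction (𝔛 ≃ₜ 𝔛) E]
    [MulAction (𝔛 ≃ₜ 𝔛) B] (f : E →[𝔛 ≃ₜ 𝔛] B) (hf : Function.Bijective f) :
    wt 𝔛 c (Set.univ : Set E) = wt 𝔛 c (Set.univ : Set B) := by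
  rw [← wt_image (map_smul f) hf.1, Set.image_univ, hf.2.range_eq]

variable (𝔛) in
/-- The measure `μ` with `μ(X(n)) = c ^ (n - 1)`, for `c = -1` or `c = -2`. -/
noncomputable def cantorMeasure (c : ℚ) (hc : (c + 1) * (c + 2) = 0) : GMeasure (𝔛 ≃ₜ 𝔛) ℚ where
  val {A B} _ _ := wt 𝔛 c (Set.univ : Set A) / wt 𝔛 c (Set.univ : Set B)
  val_iso {A B} hB f hf := by
    rw [wt_univ_eq_of_bijective c f hf,
      div_self (FinGSet.wt_univ_ne_zero (ne_zero_of_mul_eq_zero hc) hB)]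
  val_coprod {A A₁ A₂ B} hB f i₁ i₂ h := by
    classical
    have := A.finitary
    have h1 : Function.Injective i₁ := h.1.comp Sum.inl_injective
    have h2 : Function.Injective i₂ := h.1.comp Sum.inr_injective
    rw [← add_div, wt_eq_sum c (fun a => decide (a ∈ Set.range i₁)) (Set.univ : Set A)
      (finite_fixedIn_univ A.smooth _), Fintype.sum_bool, ← wt_image (map_smul i₁) h1,
      ← wt_image (map_smul i₂) h2]
    congr 3
    · ext a
      simp
    · ext a
      simp only [Set.mem_univ, true_and, decide_eq_false_iff_not, Set.mem_ofPred_eq,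
        Set.image_univ]
      constructor
      · intro ha
        obtain ⟨x | x, rfl⟩ := h.2 a
        · exact absurd ⟨x, rfl⟩ ha
        · exact ⟨x, rfl⟩
      · rintro ⟨x, rfl⟩ ⟨y, hy⟩
        exact Sum.inl_ne_inr (h.1 (a₁ := Sum.inl y) (a₂ := Sum.inr x) hy)
  val_comp {A B C} hB hC g f := by
    rw [mul_comm, div_mul_div_cancel₀ (FinGSet.wt_univ_ne_zero (ne_zero_of_mul_eq_zero hc) hB)]
  val_baseChange {A B A' B'} hB hB' f g f' g' h h' := by
    have := A.finitary
    have := B'.finitary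
    have := hB.2
    have key := wt_fiberProduct hc (map_smul f) (map_smul g) A.smooth B'.smooth B.smooth
    have hA' : wt 𝔛 c {z : A × B' | f z.1 = g z.2} = wt 𝔛 c (Set.univ : Set A') := by
      rw [← wt_image (p := fun a' => (g' a', f' a'))
        (fun γ e => Prod.ext (map_smul g' γ e) (map_smul f' γ e)) ?_]
      · congr 1
        ext ⟨a, b'⟩
        constructor
        · intro hz
          obtain ⟨a', ⟨h1, h2⟩, -⟩ := h' a b' hz
          exact ⟨a', trivial, Prod.ext h1 h2⟩
        · rintro ⟨a', -, ha'⟩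
          obtain ⟨rfl, rfl⟩ := Prod.mk.injEq .. ▸ ha'
          exact h a'
      · intro a₁ a₂ ha
        obtain ⟨h1, h2⟩ := Prod.mk.injEq .. ▸ ha
        exact (h' _ _ (h a₁)).unique ⟨rfl, rfl⟩ ⟨h1.symm, h2.symm⟩
    rw [hA'] at key
    rw [div_eq_div_iff (FinGSet.wt_univ_ne_zero (ne_zero_of_mul_eq_zero hc) hB')
      (FinGSet.wt_univ_ne_zero (ne_zero_of_mul_eq_zero hc) hB), key]

theorem cantorMeasure_isRegular (c : ℚ) (hc : (c + 1) * (c + 2) = 0) :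
    (cantorMeasure 𝔛 c hc).IsRegular := fun hA hB _ =>
  isUnit_iff_ne_zero.2 (div_ne_zero (FinGSet.wt_univ_ne_zero (ne_zero_of_mul_eq_zero hc) hA)
    (FinGSet.wt_univ_ne_zero (ne_zero_of_mul_eq_zero hc) hB))

theorem cantorMeasure_ofSet_X (c : ℚ) (hc : (c + 1) * (c + 2) = 0) (n : ℕ) :
    (cantorMeasure 𝔛 c hc).ofSet (X 𝔛 (n + 1)) = c ^ n := by
  have h1 : wt 𝔛 c (Set.univ : Set (FinGSet.one (𝔛 ≃ₜ 𝔛))) = 1 := by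
    -- 𝟏 is X(1), so its weight is c^0.
    have hb : Function.Bijective (X 𝔛 1).toOne := by
      refine ⟨fun φ ψ _ => XSet.ext (𝔛 := 𝔛) fun x => Subsingleton.elim (α := Fin 1) _ _,
        fun y => ⟨basePoint 𝔛 0, rfl⟩⟩
    rw [← wt_univ_eq_of_bijective c _ hb]
    exact (wt_XSet c 0).trans (pow_zero c)
  change wt 𝔛 c (Set.univ : Set (X 𝔛 (n + 1)))
    / wt 𝔛 c (Set.univ : Set (FinGSet.one (𝔛 ≃ₜ 𝔛))) = c ^ n
  rw [h1, div_one]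
  exact wt_XSet c n

end Existence

/-! ### Reduction to orbits and uniqueness. -/

section Uniqueness

section General

variable {G : Type u} [Group G] [TopologicalSpace G] {k : Type*} [CommRing k]

/-- An invariant subset of a finitary `G`-set. -/
def FinGSet.sub (A : FinGSet G) (T : SubMulAction G A) : FinGSet G where
  carrier := T
  action := inferInstance
  smooth x := by
    rw [SubMulAction.stabilizer_of_subMul]
    exact A.smooth x
  finitary := by
    have := A.finitary
    refine Finite.of_injective (β := MulAction.orbitRel.Quotient G A)
      (Quotient.map' (fun x : T => (x : A)) ?_) ?_
    · rintro x y ⟨g, rfl⟩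
      exact ⟨g, rfl⟩
    · rintro ⟨x⟩ ⟨y⟩ h
      obtain ⟨g, hg⟩ := MulAction.orbitRel_apply.1 (Quotient.exact' h)
      exact Quotient.sound' ⟨g, Subtype.ext hg⟩

/-- The union of a set of orbits. -/
def FinGSet.orbitUnion (A : FinGSet G) (s : Set (MulAction.orbitRel.Quotient G A)) : FinGSet G :=
  A.sub
    { carrier := {x | (Quotient.mk'' x : MulAction.orbitRel.Quotient G A) ∈ s}
      smul_mem' := fun g x hx => by
        have : (Quotient.mk'' (g • x) : MulAction.orbitRel.Quotient G A) = Quotient.mk'' x :=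
          Quotient.sound' ⟨g, rfl⟩
        change (Quotient.mk'' (g • x) : MulAction.orbitRel.Quotient G A) ∈ s
        rwa [this] }

/-- The inclusion of one union of orbits into another. -/
def FinGSet.orbitUnionMap (A : FinGSet G) {s t : Set (MulAction.orbitRel.Quotient G A)}
    (h : s ⊆ t) : A.orbitUnion s →[G] A.orbitUnion t where
  toFun x := ⟨x.1, h x.2⟩
  map_smul' _ _ := rfl

/-- The inclusion of a union of orbits. -/
def FinGSet.orbitUnionIncl (A : FinGSet G) (s : Set (MulAction.orbitRel.Quotient G A)) :
    A.orbitUnion s →[G] A where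
  toFun x := x.1
  map_smul' _ _ := rfl

namespace GMeasure

variable (μ : GMeasure G k)

theorem ofSet_add {A A₁ A₂ : FinGSet G} (i₁ : A₁ →[G] A) (i₂ : A₂ →[G] A)
    (h : Function.Bijective (Sum.elim i₁ i₂)) : μ.ofSet A = μ.ofSet A₁ + μ.ofSet A₂ :=
  μ.val_coprod _ _ i₁ i₂ h

theorem ofSet_eq_mul {A B : FinGSet G} (hB : B.IsTransitive) (f : A →[G] B) :
    μ.ofSet A = μ.ofSet B * μ.val hB f :=
  μ.val_comp hB _ B.toOne f

/-- The empty set is the disjoint union of two copies of itself. -/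
theorem ofSet_of_isEmpty (A : FinGSet G) [IsEmpty A] : μ.ofSet A = 0 := by
  have := μ.ofSet_add (A := A) (A₁ := A) (A₂ := A) (MulActionHom.id G) (MulActionHom.id G)
    ⟨fun x => (x.elim isEmptyElim isEmptyElim), isEmptyElim⟩
  simpa using this

theorem ofSet_orbitUnion_eq (μ' : GMeasure G k) {A : FinGSet G}
    (h : ∀ o, μ.ofSet (A.orbitUnion {o}) = μ'.ofSet (A.orbitUnion {o}))
    (s : Finset (MulAction.orbitRel.Quotient G A)) :
    μ.ofSet (A.orbitUnion s) = μ'.ofSet (A.orbitUnion s) := by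
  classical
  induction s using Finset.induction_on with
  | empty =>
    have : IsEmpty (A.orbitUnion (∅ : Finset (MulAction.orbitRel.Quotient G A))) :=
      ⟨fun x => Finset.notMem_empty _ x.2⟩
    rw [ofSet_of_isEmpty, ofSet_of_isEmpty]
  | insert o s ho ih =>
    have hb : Function.Bijective (Sum.elim
        (A.orbitUnionMap (s := {o}) (t := (insert o s : Finset _)) (by simp))
        (A.orbitUnionMap (s := s) (t := (insert o s : Finset _)) (by simp))) := by
      have hval {x y : A.orbitUnion ((insert o s : Finset _) : Set _)} (h : x = y) :
          (x.1 : A) = y.1 := congrArg Subtype.val h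
      have hdisj (x : A) (h1 : (Quotient.mk'' x : MulAction.orbitRel.Quotient G A) = o)
          (h2 : (Quotient.mk'' x : MulAction.orbitRel.Quotient G A) ∈ s) : False := ho (h1 ▸ h2)
      constructor
      · rintro (x | x) (y | y) hxy
        · exact congrArg _ (Subtype.ext (hval hxy))
        · have h1 : x.1 = y.1 := hval hxy
          exact (hdisj y.1 (h1 ▸ x.2) y.2).elim
        · have h1 : x.1 = y.1 := hval hxy
          exact (hdisj x.1 (h1 ▸ y.2) x.2).elim
        · exact congrArg _ (Subtype.ext (hval hxy))
      · rintro ⟨x, hx⟩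
        rcases Finset.mem_insert.1 hx with h1 | h1
        · exact ⟨Sum.inl ⟨x, h1⟩, rfl⟩
        · exact ⟨Sum.inr ⟨x, h1⟩, rfl⟩
    rw [μ.ofSet_add _ _ hb, μ'.ofSet_add _ _ hb, ih, h]

/-- Measures that agree on the orbits of `A` agree on `A`. -/
theorem ofSet_eq_of_orbits (μ' : GMeasure G k) {A : FinGSet G}
    (h : ∀ o, μ.ofSet (A.orbitUnion {o}) = μ'.ofSet (A.orbitUnion {o})) :
    μ.ofSet A = μ'.ofSet A := by
  have := A.finitary
  let _ := Fintype.ofFinite (MulAction.orbitRel.Quotient G A)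
  -- The empty second part lets additivity alone identify A with the union of all its orbits.
  have h1 : ∀ ν : GMeasure G k, ν.ofSet A
      = ν.ofSet (A.orbitUnion ((Finset.univ : Finset (MulAction.orbitRel.Quotient G A)) : Set _))
        + ν.ofSet (A.orbitUnion ((∅ : Finset (MulAction.orbitRel.Quotient G A)) : Set _)) := by
    intro ν
    refine ν.ofSet_add (A.orbitUnionIncl _) (A.orbitUnionIncl _) ⟨?_, fun x =>
      ⟨Sum.inl ⟨x, Finset.mem_univ _⟩, rfl⟩⟩
    rintro (x | x) (y | y) hxy
    · exact congrArg _ (Subtype.ext hxy)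
    · exact absurd y.2 (Finset.notMem_empty _)
    · exact absurd x.2 (Finset.notMem_empty _)
    · exact absurd x.2 (Finset.notMem_empty _)
  rw [h1, h1, ofSet_orbitUnion_eq μ μ' h, ofSet_orbitUnion_eq μ μ' h]

end GMeasure

theorem FinGSet.orbitUnion_singleton_isTransitive (A : FinGSet G)
    (o : MulAction.orbitRel.Quotient G A) : (A.orbitUnion {o}).IsTransitive := by
  refine ⟨⟨⟨o.out, Quotient.out_eq' o⟩⟩, ⟨fun x y => ?_⟩⟩
  have h : (Quotient.mk'' y.1 : MulAction.orbitRel.Quotient G A) = Quotient.mk'' x.1 :=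
    Eq.trans (b := o) y.2 (Eq.symm x.2)
  obtain ⟨g, hg⟩ := MulAction.orbitRel_apply.1 (Quotient.exact' h)
  exact ⟨g, Subtype.ext hg⟩

end General

variable {𝔛 : Type u} [TopologicalSpace 𝔛] [IsCantorSpace 𝔛]

/-- The range is a complete invariant of orbits, with finitely many values. -/
theorem IsEvaluation.finite_quotient {E F : Type*} [Finite F] [MulAction (𝔛 ≃ₜ 𝔛) E]
    {ev : E → 𝔛 → F} (hev : IsEvaluation ev) :
    Finite (MulAction.orbitRel.Quotient (𝔛 ≃ₜ 𝔛) E) := by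
  refine Finite.of_injective (β := Set F) (fun o => Set.range (ev o.out)) fun o o' h => ?_
  obtain ⟨g, hg⟩ := exists_homeo_of_range_eq (hev.isLocallyConstant _)
    (hev.isLocallyConstant _) h
  have h1 : g • o.out = o'.out := hev.injective (funext fun x => (hev.smul_apply g _ x).trans (hg x))
  rw [← Quotient.out_eq' o, ← Quotient.out_eq' o', ← h1]
  exact (Quotient.sound' (MulAction.orbitRel_apply.2 ⟨g, rfl⟩)).symm

theorem X_isTransitive (n : ℕ) : (X 𝔛 (n + 1)).IsTransitive :=
  ⟨nonempty_XSet 𝔛 n, XSet.transitive 𝔛 (n + 1)⟩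

/-- The product `X(n) × X(n)`. -/
def XProd (𝔛 : Type u) [TopologicalSpace 𝔛] [IsCantorSpace 𝔛] (n : ℕ) : FinGSet (𝔛 ≃ₜ 𝔛) where
  carrier := XSet 𝔛 n × XSet 𝔛 n
  action := inferInstance
  smooth z := isOpen_stabilizer_prod (XSet.smooth 𝔛 n z.1) (XSet.smooth 𝔛 n z.2)
  finitary := ((XSet.isEvaluation n).prod (XSet.isEvaluation n)).finite_quotient

/-- The fibre product of `X(n)` with itself over `B`. -/
def selfProduct {n : ℕ} {B : FinGSet (𝔛 ≃ₜ 𝔛)} (p : X 𝔛 n →[𝔛 ≃ₜ 𝔛] B) : FinGSet (𝔛 ≃ₜ 𝔛) :=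
  (XProd 𝔛 n).sub
    { carrier := {z : XSet 𝔛 n × XSet 𝔛 n | p z.1 = p z.2}
      smul_mem' := fun g z (hz : p z.1 = p z.2) => by
        have h1 := map_smul p g z.1
        have h2 := map_smul p g z.2
        exact h1.trans ((congrArg _ hz).trans h2.symm) }

/-- The first projection of `selfProduct p`. -/
def selfProductFst {n : ℕ} {B : FinGSet (𝔛 ≃ₜ 𝔛)} (p : X 𝔛 n →[𝔛 ≃ₜ 𝔛] B) :
    selfProduct p →[𝔛 ≃ₜ 𝔛] X 𝔛 n where
  toFun z := z.1.1
  map_smul' _ _ := rfl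

/-- The second projection of `selfProduct p`. -/
def selfProductSnd {n : ℕ} {B : FinGSet (𝔛 ≃ₜ 𝔛)} (p : X 𝔛 n →[𝔛 ≃ₜ 𝔛] B) :
    selfProduct p →[𝔛 ≃ₜ 𝔛] X 𝔛 n where
  toFun z := z.1.2
  map_smul' _ _ := rfl

/-- For (φ, ψ) in the orbit, the stabilizer of φ keeps ψ in a finite fibre of p, hence fixes it. So
φ determines ψ within the orbit. -/
theorem bijective_selfProductFst {n : ℕ} {B : FinGSet (𝔛 ≃ₜ 𝔛)} (p : X 𝔛 (n + 1) →[𝔛 ≃ₜ 𝔛] B)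
    (hp : ∀ φ : XSet 𝔛 (n + 1), {ψ : XSet 𝔛 (n + 1) | p ψ = p φ}.Finite)
    (o : MulAction.orbitRel.Quotient (𝔛 ≃ₜ 𝔛) (selfProduct p)) :
    Function.Bijective ((selfProductFst p).comp ((selfProduct p).orbitUnionIncl {o})) := by
  obtain ⟨⟨z₀⟩, ht⟩ := (selfProduct p).orbitUnion_singleton_isTransitive o
  constructor
  · intro z w hzw
    obtain ⟨g, rfl⟩ := MulAction.exists_smul_eq (𝔛 ≃ₜ 𝔛) z w
    have hzp : p z.1.1.1 = p z.1.1.2 := z.1.2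
    have h1 : g ∈ MulAction.stabilizer (𝔛 ≃ₜ 𝔛) (z.1.1.1 : XSet 𝔛 (n + 1)) := Eq.symm hzw
    have h2 := fixed_of_finite_orbit (z.1.1.1 : XSet 𝔛 (n + 1)) (z.1.1.2 : XSet 𝔛 (n + 1))
      (XSet.smooth 𝔛 _ _) ((hp z.1.1.1).subset ?_) g h1
    · exact Subtype.ext (Subtype.ext (Prod.ext hzw h2.symm))
    · rintro _ ⟨h, hh, rfl⟩
      have h3 : p (h • z.1.1.2) = h • p z.1.1.2 := map_smul p h z.1.1.2
      have h4 : p (h • z.1.1.1) = h • p z.1.1.1 := map_smul p h z.1.1.1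
      have h5 : h • z.1.1.1 = z.1.1.1 := hh
      rw [h5, hzp, ← h3] at h4
      exact h4.symm.trans hzp.symm
  · intro φ
    have := (X_isTransitive (𝔛 := 𝔛) n).2
    obtain ⟨g, hg⟩ := MulAction.exists_smul_eq (𝔛 ≃ₜ 𝔛)
      ((selfProductFst p).comp ((selfProduct p).orbitUnionIncl {o}) z₀) φ
    exact ⟨g • z₀, hg⟩

theorem GMeasure.ofSet_selfProduct_eq {μ μ' : GMeasure (𝔛 ≃ₜ 𝔛) ℚ} {n : ℕ}
    (h : μ.ofSet (X 𝔛 (n + 1)) = μ'.ofSet (X 𝔛 (n + 1)))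
    {B : FinGSet (𝔛 ≃ₜ 𝔛)} (p : X 𝔛 (n + 1) →[𝔛 ≃ₜ 𝔛] B)
    (hp : ∀ φ : XSet 𝔛 (n + 1), {ψ : XSet 𝔛 (n + 1) | p ψ = p φ}.Finite) :
    μ.ofSet (selfProduct p) = μ'.ofSet (selfProduct p) := by
  refine μ.ofSet_eq_of_orbits μ' fun o => ?_
  have hb := bijective_selfProductFst p hp o
  rw [μ.ofSet_eq_mul (X_isTransitive n) _, μ.val_iso _ _ hb,
    μ'.ofSet_eq_mul (X_isTransitive n) _, μ'.val_iso _ _ hb, h]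

/-- A measure that agrees with a regular measure on the `X(n)` agrees with it on all transitive
sets. -/
theorem GMeasure.ofSet_eq_of_isTransitive {μ μ' : GMeasure (𝔛 ≃ₜ 𝔛) ℚ}
    (hμ' : μ'.IsRegular) (h : ∀ n, μ.ofSet (X 𝔛 (n + 1)) = μ'.ofSet (X 𝔛 (n + 1)))
    {B : FinGSet (𝔛 ≃ₜ 𝔛)} (hB : B.IsTransitive) : μ.ofSet B = μ'.ofSet B := by
  have hBt := hB
  obtain ⟨⟨b⟩, hB2⟩ := hBt
  obtain ⟨n, p, d, hp⟩ := exists_cover b (B.smooth b)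
  rw [MulAction.orbit_eq_univ] at hp
  let p' : X 𝔛 (n + 1) →[𝔛 ≃ₜ 𝔛] B := ⟨p, hp.map_smul⟩
  have hfin : ∀ φ : XSet 𝔛 (n + 1), {ψ : XSet 𝔛 (n + 1) | p' ψ = p' φ}.Finite := fun φ =>
    (hp.finite_fiber (b := p φ) trivial).subset fun ψ hψ => ⟨trivial, hψ⟩
  have hbc : ∀ ν : GMeasure (𝔛 ≃ₜ 𝔛) ℚ,
      ν.val (X_isTransitive n) (selfProductSnd p') = ν.val hB p' := by
    intro ν
    refine ν.val_baseChange hB (X_isTransitive n) p' p' _ (selfProductFst p') (fun z => z.2)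
      fun φ ψ hφψ => ⟨⟨(φ, ψ), hφψ⟩, ⟨rfl, rfl⟩, ?_⟩
    rintro ⟨⟨φ', ψ'⟩, _⟩ ⟨rfl, rfl⟩
    rfl
  -- With `hbc` the fibre product has measure μ(X(n+1)) μ(p), so the two measures agree on p;
  -- dividing μ(X(n+1)) = μ(B) μ(p) by μ(p) gives agreement on B.
  have h1 := GMeasure.ofSet_selfProduct_eq (h n) p' hfin
  rw [μ.ofSet_eq_mul (X_isTransitive n) (selfProductSnd p'),
    μ'.ofSet_eq_mul (X_isTransitive n) (selfProductSnd p'), hbc, hbc, h n] at h1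
  have hX : μ'.ofSet (X 𝔛 (n + 1)) ≠ 0 :=
    (hμ' (X_isTransitive n) (FinGSet.one_isTransitive _) _).ne_zero
  have h2 := mul_left_cancel₀ hX h1
  have h3 := h n
  rw [μ.ofSet_eq_mul hB p', μ'.ofSet_eq_mul hB p', h2] at h3
  exact mul_right_cancel₀ (hμ' (X_isTransitive n) hB p').ne_zero h3

/-- A measure that agrees with a regular measure on the `X(n)` is equal to it. -/
theorem GMeasure.eq_of_ofSet_X_eq {μ μ' : GMeasure (𝔛 ≃ₜ 𝔛) ℚ}
    (hμ' : μ'.IsRegular) (h : ∀ n, μ.ofSet (X 𝔛 (n + 1)) = μ'.ofSet (X 𝔛 (n + 1))) : μ = μ' := by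
  have hall : ∀ A : FinGSet (𝔛 ≃ₜ 𝔛), μ.ofSet A = μ'.ofSet A := fun A =>
    μ.ofSet_eq_of_orbits μ' fun o => GMeasure.ofSet_eq_of_isTransitive hμ' h
      (A.orbitUnion_singleton_isTransitive o)
  ext A B hB f
  have h1 := hall A
  rw [μ.ofSet_eq_mul hB f, μ'.ofSet_eq_mul hB f, hall B] at h1
  exact mul_left_cancel₀ (hμ' hB (FinGSet.one_isTransitive _) _).ne_zero h1

theorem existsUnique_measure (𝔛 : Type u) [TopologicalSpace 𝔛] [IsCantorSpace 𝔛] {c : ℚ}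
    (hc : (c + 1) * (c + 2) = 0) :
    ∃! μ : GMeasure (𝔛 ≃ₜ 𝔛) ℚ,
      μ.IsRegular ∧ ∀ n : ℕ, 1 ≤ n → μ.ofSet (X 𝔛 n) = c ^ (n - 1) := by
  refine ⟨cantorMeasure 𝔛 c hc, ⟨cantorMeasure_isRegular c hc, ?_⟩, ?_⟩
  · rintro (_ | n) hn
    · omega
    · exact cantorMeasure_ofSet_X c hc n
  · rintro μ ⟨-, h⟩
    refine GMeasure.eq_of_ofSet_X_eq (cantorMeasure_isRegular c hc) fun n => ?_
    rw [cantorMeasure_ofSet_X, h (n + 1) (by omega), Nat.add_sub_cancel]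

end Uniqueness

end CantorMeas

theorem mainTheorem2 (𝔛 : Type u) [TopologicalSpace 𝔛] [CantorMeas.IsCantorSpace 𝔛] :
    (∃! μ : CantorMeas.GMeasure (𝔛 ≃ₜ 𝔛) ℚ,
      μ.IsRegular ∧ ∀ n : ℕ, 1 ≤ n → μ.ofSet (CantorMeas.X 𝔛 n) = (-2) ^ (n - 1)) ∧
    (∃! ν : CantorMeas.GMeasure (𝔛 ≃ₜ 𝔛) ℚ,
      ν.IsRegular ∧ ∀ n : ℕ, 1 ≤ n → ν.ofSet (CantorMeas.X 𝔛 n) = (-1) ^ (n - 1)) :=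
  ⟨CantorMeas.existsUnique_measure 𝔛 (by norm_num),
    CantorMeas.existsUnique_measure 𝔛 (by norm_num)⟩
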